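/- Let $(W,S)$ be a right-angled Coxeter system with $S$ finite (that is, $m(s,t)\in\{2,\infty\}$ for all $s\neq t$ in $S$), let $|\cdot|$ be the word length on $W$ with respect to $S$, let $q>0$ and put $p=(q-1)/\sqrt q$. For $s\in S$ let $T_s$ be the bounded operator on $\ell^2(W)$ with $T_s\delta_{\mathbf w}=\delta_{s\mathbf w}$ if $|s\mathbf w|>|\mathbf w|$ and $T_s\delta_{\mathbf w}=\delta_{s\mathbf w}+p\,\delta_{\mathbf w}$ otherwise, and for $\mathbf w\in W$ let $T_{\mathbf w}=T_{s_1}\cdots T_{s_k}$, where $\mathbf w=s_1\cdots s_k$ is any reduced expression. Let $\mathcal A_q$ be the $*$-algebra generated by the operators $T_{\mathbf w}$, $\mathbf w\in W$; these operators form a linear basis of $\mathcal A_q$. Let $\mathcal M_q=\mathcal A_q''$ be the Hecke von Neumann algebra. For $n\in\mathbb N=\{0,1,2,\dots\}$ let $$\Psi_{\le n}:\mathcal A_q\to\mathcal M_q$$ be the linear map with $\Psi_{\le n}(T_{\mathbf w})=T_{\mathbf w}$ if $|\mathbf w|\le n$ and $\Psi_{\le n}(T_{\mathbf w})=0$ otherwise.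 Then there is a polynomial $P$ with real coefficients such that, for every $n\in\mathbb N$, the map $\Psi_{\le n}$ is completely bounded and $$\|\Psi_{\le n}\|_{\mathcal{CB}}\le P(n).$$ -/

import Mathlib

open scoped ENNReal InnerProductSpace

noncomputable section

/-! ### Right-angled Coxeter systems -/

namespace CoxeterMatrix

/-- A Coxeter matrix is right-angled if every off-diagonal entry is `2` or `∞`
(Mathlib encodes the entry `∞` as `0`). -/
def IsRightAngled {B : Type*} (M : CoxeterMatrix B) : Prop :=
  ∀ i j, i ≠ j → M i j = 2 ∨ M i j = 0

end CoxeterMatrix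

/-! ### Complete boundedness of linear maps between concrete operator algebras -/

namespace OperatorSpace

/-- The operator on the Hilbert space direct sum `H ⊕ ⋯ ⊕ H` (`k` copies) given by a `k × k` matrix
of bounded operators on `H`. -/
def matrixOp {H : Type*} [NormedAddCommGroup H] [InnerProductSpace ℂ H] {k : ℕ}
    (x : Matrix (Fin k) (Fin k) (H →L[ℂ] H)) :
    PiLp 2 (fun _ : Fin k => H) →L[ℂ] PiLp 2 (fun _ : Fin k => H) :=
  (PiLp.continuousLinearEquiv 2 ℂ (fun _ : Fin k => H)).symm.toContinuousLinearMap ∘L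
    ContinuousLinearMap.pi (fun i => ∑ j, x i j ∘L ContinuousLinearMap.proj j) ∘L
    (PiLp.continuousLinearEquiv 2 ℂ (fun _ : Fin k => H)).toContinuousLinearMap

theorem matrixOp_apply {H : Type*} [NormedAddCommGroup H] [InnerProductSpace ℂ H] {k : ℕ}
    (x : Matrix (Fin k) (Fin k) (H →L[ℂ] H))
    (ξ : PiLp 2 (fun _ : Fin k => H)) (i : Fin k) :
    matrixOp x ξ i = ∑ j, x i j (ξ j) := by
  simp [matrixOp]

variable {H K : Type*} [NormedAddCommGroup H] [InnerProductSpace ℂ H] [CompleteSpace H]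
  [NormedAddCommGroup K] [InnerProductSpace ℂ K] [CompleteSpace K]

/-- The completely bounded norm `sup_k ‖id_{M_k} ⊗ φ‖`, where the `k × k` matrices over `A`
and over `B` carry the operator norms of `B(H ⊕ ⋯ ⊕ H)` and `B(K ⊕ ⋯ ⊕ K)`. -/
def cbNorm {A : StarSubalgebra ℂ (H →L[ℂ] H)} {B : StarSubalgebra ℂ (K →L[ℂ] K)}
    (φ : A →ₗ[ℂ] B) : ℝ≥0∞ :=
  ⨆ (k : ℕ) (x : Matrix (Fin k) (Fin k) A)
    (_ : ‖matrixOp (x.map fun a => (a : H →L[ℂ] H))‖ ≤ 1),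
      ‖matrixOp (x.map fun a => (φ a : K →L[ℂ] K))‖ₑ

/-- A linear map is completely bounded if its completely bounded norm is finite. -/
def IsCompletelyBounded {A : StarSubalgebra ℂ (H →L[ℂ] H)} {B : StarSubalgebra ℂ (K →L[ℂ] K)}
    (φ : A →ₗ[ℂ] B) : Prop :=
  cbNorm φ < ∞

/-- The von Neumann algebra generated by a `*`-algebra of bounded operators: its bicommutant. -/
def bicommutant (A : StarSubalgebra ℂ (H →L[ℂ] H)) : VonNeumannAlgebra H where
  toStarSubalgebra :=
    StarSubalgebra.centralizer ℂ (StarSubalgebra.centralizer ℂ (A : Set (H →L[ℂ] H)) :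
      Set (H →L[ℂ] H))
  centralizer_centralizer' := by
    change Set.centralizer (Set.centralizer ((StarSubalgebra.centralizer ℂ
      (StarSubalgebra.centralizer ℂ (A : Set (H →L[ℂ] H)) : Set (H →L[ℂ] H)) :
        StarSubalgebra ℂ (H →L[ℂ] H)) : Set (H →L[ℂ] H))) = _
    rw [StarSubalgebra.coe_centralizer_centralizer, Set.centralizer_centralizer_centralizer]
    exact (StarSubalgebra.coe_centralizer_centralizer (R := ℂ) (A : Set (H →L[ℂ] H))).symm

theorem le_bicommutant (A : StarSubalgebra ℂ (H →L[ℂ] H)) :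
    A ≤ (bicommutant A).toStarSubalgebra := by
  intro a ha
  change a ∈ StarSubalgebra.centralizer ℂ _
  rw [StarSubalgebra.mem_centralizer_iff]
  intro g hg
  have hg' := (StarSubalgebra.mem_centralizer_iff ℂ).1 hg
  have h1 := (hg' a ha).1
  have h2 := (hg' (star a) (star_mem ha)).1
  refine ⟨h1.symm, ?_⟩
  have := congrArg star h2
  simpa using this

end OperatorSpace

/-! ### Two kinds of operators on `ℓ²(X)` -/

namespace Hecke

section l2

variable {X : Type*}

/-- The Hilbert space `ℓ²(X)`. -/
abbrev L2 (X : Type*) : Type _ := lp (fun _ : X => ℂ) 2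

open scoped Classical in
/-- The standard orthonormal basis vectors `δ_x` of `ℓ²(X)`. -/
def delta (x : X) : L2 X := lp.single 2 x (1 : ℂ)

theorem delta_apply_self (x : X) : (delta x : L2 X) x = 1 := by
  classical
  simp [delta]

theorem delta_apply_ne {x y : X} (h : y ≠ x) : (delta x : L2 X) y = 0 := by
  classical
  simp [delta, lp.single_apply, h]

theorem memlp_comp_equiv (e : Equiv.Perm X) (f : L2 X) :
    Memℓp (fun x => f (e x)) 2 := by
  have h := (lp.memℓp f).summable (by norm_num)
  exact memℓp_gen ((e.summable_iff (f := fun x => ‖f x‖ ^ (2 : ℝ≥0∞).toReal)).2 h)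

/-- The unitary operator `δ_x ↦ δ_{e x}` on `ℓ²(X)` given by a permutation `e` of `X`. -/
def permOp (e : Equiv.Perm X) : L2 X →L[ℂ] L2 X :=
  LinearMap.mkContinuous
    { toFun := fun f => ⟨fun x => f (e.symm x), memlp_comp_equiv e.symm f⟩
      map_add' := fun f g => by ext x; rfl
      map_smul' := fun c f => by ext x; rfl } 1 (by
    intro f
    rw [one_mul]
    refine lp.norm_le_of_tsum_le (by norm_num) (norm_nonneg _) ?_
    rw [lp.norm_rpow_eq_tsum (by norm_num) f]
    exact (e.symm.tsum_eq (fun x => ‖f x‖ ^ (2 : ℝ≥0∞).toReal)).le)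

theorem permOp_apply (e : Equiv.Perm X) (f : L2 X) (x : X) :
    permOp e f x = f (e.symm x) := rfl

theorem permOp_delta (e : Equiv.Perm X) (x : X) : permOp e (delta x) = delta (e x) := by
  ext y
  rw [permOp_apply]
  by_cases h : y = e x
  · subst h
    rw [Equiv.symm_apply_apply, delta_apply_self, delta_apply_self]
  · rw [delta_apply_ne h, delta_apply_ne]
    intro h'
    exact h (by rw [← h', Equiv.apply_symm_apply])

open scoped Classical in
/-- The orthogonal projection of `ℓ²(X)` onto the closed span of `{δ_x | x ∈ D}`. -/
def projOp (D : Set X) : L2 X →L[ℂ] L2 X :=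
  LinearMap.mkContinuous
    { toFun := fun f => ⟨fun x => if x ∈ D then f x else 0,
        (lp.memℓp f).mono' fun x => by split_ifs <;> simp⟩
      map_add' := fun f g => by
        ext x
        change (if x ∈ D then f x + g x else 0 : ℂ) =
          (if x ∈ D then f x else 0) + (if x ∈ D then g x else 0)
        split_ifs <;> simp
      map_smul' := fun c f => by ext x; by_cases h : x ∈ D <;> simp [h] } 1 (by
    intro f
    rw [one_mul]
    refine lp.norm_mono (by norm_num) fun x => ?_
    change ‖(if x ∈ D then f x else 0 : ℂ)‖ ≤ ‖f x‖
    split_ifs <;> simp)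

open scoped Classical in
theorem projOp_apply (D : Set X) (f : L2 X) (x : X) :
    projOp D f x = if x ∈ D then f x else 0 := rfl

open scoped Classical in
theorem projOp_delta (D : Set X) (x : X) :
    projOp D (delta x) = if x ∈ D then delta x else 0 := by
  ext y
  rw [projOp_apply]
  by_cases h : y = x
  · subst h
    by_cases hy : y ∈ D <;> simp [hy]
  · by_cases hx : x ∈ D <;> simp [hx, delta_apply_ne h]

theorem clm_ext {S T : L2 X →L[ℂ] L2 X} (h : ∀ x, S (delta x) = T (delta x)) : S = T := by
  classical
  refine lp.ext_continuousLinearMap (𝕜 := ℂ) (by norm_num) fun x => ?_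
  ext1
  exact h x

theorem star_permOp (e : Equiv.Perm X) (he : e.symm = e) : star (permOp e) = permOp e := by
  rw [ContinuousLinearMap.star_eq_adjoint, eq_comm, ContinuousLinearMap.eq_adjoint_iff]
  intro f g
  rw [lp.inner_eq_tsum, lp.inner_eq_tsum, ← e.tsum_eq]
  refine tsum_congr fun x => ?_
  rw [permOp_apply, permOp_apply, Equiv.symm_apply_apply, he]

theorem star_projOp (D : Set X) : star (projOp D) = projOp D := by
  rw [ContinuousLinearMap.star_eq_adjoint, eq_comm, ContinuousLinearMap.eq_adjoint_iff]
  intro f g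
  rw [lp.inner_eq_tsum, lp.inner_eq_tsum]
  refine tsum_congr fun x => ?_
  rw [projOp_apply, projOp_apply]
  by_cases h : x ∈ D <;> simp [h]

theorem linearIndependent_delta : LinearIndependent ℂ (delta : X → L2 X) := by
  classical
  have : Orthonormal ℂ (delta : X → L2 X) := by
    rw [orthonormal_iff_ite]
    intro x y
    rw [delta, lp.inner_single_left]
    by_cases h : x = y
    · subst h; simp [delta_apply_self]
    · simp [h, delta_apply_ne h]
  exact this.linearIndependent

end l2

/-! ### Descents in right-angled Coxeter groups -/

section descents

variable {B W : Type*} [Group W] {M : CoxeterMatrix B}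

open scoped Classical in
/-- The permutation `(t, ε) ↦ (s t s, ε + [t = s])` attached to a simple reflection `s`. -/
def signPerm (cs : CoxeterSystem M W) (i : B) : Equiv.Perm (W × ZMod 2) where
  toFun z := (cs.simple i * z.1 * cs.simple i, z.2 + if z.1 = cs.simple i then 1 else 0)
  invFun z := (cs.simple i * z.1 * cs.simple i, z.2 + if z.1 = cs.simple i then 1 else 0)
  left_inv := by
    rintro ⟨t, ε⟩
    have h : cs.simple i * t * cs.simple i = cs.simple i ↔ t = cs.simple i := by
      rw [mul_eq_right, mul_eq_one_iff_inv_eq, cs.inv_simple, eq_comm]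
    ext
    · simp [mul_assoc]
    · by_cases ht : t = cs.simple i <;> simp [ht, add_assoc, h, CharTwo.add_self_eq_zero]
  right_inv := by
    rintro ⟨t, ε⟩
    have h : cs.simple i * t * cs.simple i = cs.simple i ↔ t = cs.simple i := by
      rw [mul_eq_right, mul_eq_one_iff_inv_eq, cs.inv_simple, eq_comm]
    ext
    · simp [mul_assoc]
    · by_cases ht : t = cs.simple i <;> simp [ht, add_assoc, h, CharTwo.add_self_eq_zero]

open scoped Classical in
theorem signPerm_apply (cs : CoxeterSystem M W) (i : B) (z : W × ZMod 2) :
    signPerm cs i z =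
      (cs.simple i * z.1 * cs.simple i, z.2 + if z.1 = cs.simple i then 1 else 0) := rfl

theorem isLiftable_signPerm (hM : M.IsRightAngled) (cs : CoxeterSystem M W) :
    M.IsLiftable (signPerm cs) := by
  classical
  intro i j
  by_cases hij : i = j
  · subst hij
    rw [M.diagonal, pow_one]
    exact Equiv.ext fun z => (signPerm cs i).left_inv z
  rcases hM i j hij with h | h
  · rw [h, pow_two]
    have hc : cs.simple i * cs.simple j = cs.simple j * cs.simple i := by
      have := cs.simple_mul_simple_pow i j
      rw [h, pow_two, mul_eq_one_iff_eq_inv, mul_inv_rev, cs.inv_simple, cs.inv_simple] at this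
      exact this
    have hc' : ∀ x, cs.simple i * (cs.simple j * x) = cs.simple j * (cs.simple i * x) := by
      intro x; rw [← mul_assoc, hc, mul_assoc]
    have key : ∀ a b : B, cs.simple a * cs.simple b = cs.simple b * cs.simple a →
        ∀ t, (cs.simple a * t * cs.simple a = cs.simple b ↔ t = cs.simple b) := by
      intro a b hab t
      constructor
      · intro h1
        have : cs.simple a * (cs.simple a * t * cs.simple a) * cs.simple a =
            cs.simple a * cs.simple b * cs.simple a := by rw [h1]
        rw [hab] at this
        simpa [mul_assoc] using this
      · rintro rfl
        rw [hab]; simp [mul_assoc]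
    refine Equiv.ext fun z => ?_
    obtain ⟨t, ε⟩ := z
    simp only [Equiv.Perm.mul_apply, signPerm_apply, Equiv.Perm.one_apply, key j i hc.symm,
      key i j hc, key j j rfl, key i i rfl]
    ext
    · simp [mul_assoc, hc, hc']
    · generalize (if t = cs.simple j then (1 : ZMod 2) else 0) = a
      generalize (if t = cs.simple i then (1 : ZMod 2) else 0) = b
      have ha := CharTwo.add_self_eq_zero a
      have hb := CharTwo.add_self_eq_zero b
      linear_combination ha + hb
  · rw [h, pow_zero]

/-- The parity with which `t` occurs in a right inversion sequence of `w`. -/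
def parity (hM : M.IsRightAngled) (cs : CoxeterSystem M W) (w t : W) : ZMod 2 :=
  (cs.lift ⟨signPerm cs, isLiftable_signPerm hM cs⟩ w (t, 0)).2

open scoped Classical in
theorem lift_signPerm (hM : M.IsRightAngled) (cs : CoxeterSystem M W) (w t : W) (ε : ZMod 2) :
    cs.lift ⟨signPerm cs, isLiftable_signPerm hM cs⟩ w (t, ε) =
      (w * t * w⁻¹, ε + parity hM cs w t) := by
  induction w using cs.simple_induction_left generalizing ε with
  | one => simp [parity]
  | mul_simple_left w i ih =>
    have h0 := ih 0
    rw [parity]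
    rw [map_mul, Equiv.Perm.mul_apply, Equiv.Perm.mul_apply, ih, h0, cs.lift_apply_simple,
      signPerm_apply, signPerm_apply]
    ext
    · simp [mul_assoc]
    · simp [add_assoc]

open scoped Classical in
theorem parity_simple_mul (hM : M.IsRightAngled) (cs : CoxeterSystem M W) (w t : W) (i : B) :
    parity hM cs (cs.simple i * w) t =
      parity hM cs w t + if w * t * w⁻¹ = cs.simple i then 1 else 0 := by
  rw [parity, map_mul, Equiv.Perm.mul_apply, lift_signPerm hM cs w, cs.lift_apply_simple, signPerm_apply]
  simp

theorem parity_one (hM : M.IsRightAngled) (cs : CoxeterSystem M W) (t : W) :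
    parity hM cs 1 t = 0 := by
  simp [parity]

theorem mem_rightInvSeq_of_parity (hM : M.IsRightAngled) (cs : CoxeterSystem M W) (ω : List B)
    (t : W) (h : parity hM cs (cs.wordProd ω) t ≠ 0) : t ∈ cs.rightInvSeq ω := by
  induction ω with
  | nil => simp [parity_one] at h
  | cons i ω ih =>
    rw [cs.wordProd_cons, parity_simple_mul] at h
    rw [CoxeterSystem.rightInvSeq, List.mem_cons]
    by_cases h' : cs.wordProd ω * t * (cs.wordProd ω)⁻¹ = cs.simple i
    · left; rw [← h']; group
    · right
      refine ih ?_
      simpa [h'] using h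

theorem parity_mul_simple_self (hM : M.IsRightAngled) (cs : CoxeterSystem M W) (w : W) (i : B) :
    parity hM cs (w * cs.simple i) (cs.simple i) = parity hM cs w (cs.simple i) + 1 := by
  rw [parity, map_mul, Equiv.Perm.mul_apply, cs.lift_apply_simple, signPerm_apply, lift_signPerm hM]
  simp [add_comm]

theorem isRightDescent_iff_parity (hM : M.IsRightAngled) (cs : CoxeterSystem M W) (w : W) (i : B) :
    cs.IsRightDescent w i ↔ parity hM cs w (cs.simple i) ≠ 0 := by
  have key : ∀ v, parity hM cs v (cs.simple i) ≠ 0 → cs.IsRightDescent v i := by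
    intro v hv
    obtain ⟨ω, hω, rfl⟩ := cs.exists_isReduced v
    exact (cs.isRightInversion_of_mem_rightInvSeq hω (mem_rightInvSeq_of_parity hM cs ω _ hv)).2
  refine ⟨fun h h0 => ?_, key w⟩
  have h1 := key (w * cs.simple i) (by rw [parity_mul_simple_self, h0]; simp)
  exact cs.isRightDescent_iff_not_isRightDescent_mul.1 h h1

/-- Left multiplication by `s` does not change whether `t` is a right descent, unless
`s w = w t`. -/
theorem isRightDescent_simple_mul (hM : M.IsRightAngled) (cs : CoxeterSystem M W) (w : W)
    (i j : B) (h : cs.simple i * w ≠ w * cs.simple j) :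
    cs.IsRightDescent (cs.simple i * w) j ↔ cs.IsRightDescent w j := by
  rw [isRightDescent_iff_parity hM, isRightDescent_iff_parity hM, parity_simple_mul, if_neg,
    add_zero]
  intro h'
  apply h
  rw [← h']; group

theorem isLeftDescent_mul_simple (hM : M.IsRightAngled) (cs : CoxeterSystem M W) (w : W)
    (i j : B) (h : cs.simple i * w ≠ w * cs.simple j) :
    cs.IsLeftDescent (w * cs.simple j) i ↔ cs.IsLeftDescent w i := by
  rw [← cs.isRightDescent_inv_iff, ← cs.isRightDescent_inv_iff, mul_inv_rev, cs.inv_simple]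
  refine isRightDescent_simple_mul hM cs _ _ _ fun h' => h ?_
  have := congrArg (·⁻¹) h'
  simpa using this.symm

end descents

/-! ### The Hecke algebra on `ℓ²(W)` -/

section algebra

variable {B W : Type*} [Group W] {M : CoxeterMatrix B}

/-- The parameter `p = (q - 1) / √q`. -/
def param (q : ℝ) : ℂ := (((q - 1) / √q : ℝ) : ℂ)

/-- The generator `T_s` for `s = s_i`, acting on `ℓ²(W)` by `δ_w ↦ δ_{s w}` if `|s w| > |w|` and
`δ_w ↦ δ_{s w} + p δ_w` if `|s w| < |w|`. -/
def gen (cs : CoxeterSystem M W) (q : ℝ) (i : B) : L2 W →L[ℂ] L2 W :=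
  permOp (Equiv.mulLeft (cs.simple i)) + param q • projOp {w | cs.IsLeftDescent w i}

open scoped Classical in
theorem gen_delta (cs : CoxeterSystem M W) (q : ℝ) (i : B) (w : W) :
    gen cs q i (delta w) =
      delta (cs.simple i * w) + (if cs.IsLeftDescent w i then param q else 0) • delta w := by
  simp only [gen, add_apply, smul_apply, permOp_delta,
    projOp_delta, Set.mem_ofPred_eq, Equiv.coe_mulLeft]
  by_cases h : cs.IsLeftDescent w i <;> simp [h]

/-- The right-handed counterpart of `gen`. -/
def rightGen (cs : CoxeterSystem M W) (q : ℝ) (i : B) : L2 W →L[ℂ] L2 W :=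
  permOp (Equiv.mulRight (cs.simple i)) + param q • projOp {w | cs.IsRightDescent w i}

open scoped Classical in
theorem rightGen_delta (cs : CoxeterSystem M W) (q : ℝ) (i : B) (w : W) :
    rightGen cs q i (delta w) =
      delta (w * cs.simple i) + (if cs.IsRightDescent w i then param q else 0) • delta w := by
  simp only [rightGen, add_apply, smul_apply, permOp_delta,
    projOp_delta, Set.mem_ofPred_eq, Equiv.coe_mulRight]
  by_cases h : cs.IsRightDescent w i <;> simp [h]

theorem star_gen (cs : CoxeterSystem M W) (q : ℝ) (i : B) : star (gen cs q i) = gen cs q i := by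
  rw [gen, star_add, star_smul, star_projOp, star_permOp]
  · simp [param]
  · ext w; simp

theorem gen_comm_rightGen (hM : M.IsRightAngled) (cs : CoxeterSystem M W) (q : ℝ) (i j : B) :
    gen cs q i * rightGen cs q j = rightGen cs q j * gen cs q i := by
  classical
  refine clm_ext fun w => ?_
  rw [mul_apply_eq_comp, mul_apply_eq_comp, rightGen_delta, gen_delta,
    map_add, map_add, map_smul, map_smul, gen_delta, gen_delta, rightGen_delta, rightGen_delta,
    mul_assoc]
  by_cases h : cs.simple i * w = w * cs.simple j
  · have h1 : cs.IsRightDescent w j ↔ cs.IsLeftDescent w i := by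
      rw [CoxeterSystem.IsRightDescent, CoxeterSystem.IsLeftDescent, h]
    have h2 : cs.IsLeftDescent (w * cs.simple j) i ↔ ¬ cs.IsLeftDescent w i := by
      rw [← h]
      have := cs.isLeftDescent_iff_not_isLeftDescent_mul (w := w) (i := i)
      tauto
    have h3 : cs.IsRightDescent (cs.simple i * w) j ↔ ¬ cs.IsRightDescent w j := by
      rw [h]
      have := cs.isRightDescent_iff_not_isRightDescent_mul (w := w) (i := j)
      tauto
    rw [h]
    by_cases h4 : cs.IsLeftDescent w i
    · have h5 := h1.2 h4
      simp only [h] at h2 h3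
      simp [h2, h3, h4, h5]
    · have h5 : ¬ cs.IsRightDescent w j := fun h' => h4 (h1.1 h')
      simp only [h] at h2 h3
      simp [h2, h3, h4, h5]
  · simp only [isRightDescent_simple_mul hM cs w i j h, isLeftDescent_mul_simple hM cs w i j h,
      smul_add, smul_smul]
    rw [mul_comm (if cs.IsRightDescent w j then param q else 0)]
    abel

/-- The product `T_{s_1} ⋯ T_{s_n}` attached to a word `s_1 ⋯ s_n`. -/
def wordOp (cs : CoxeterSystem M W) (q : ℝ) (ω : List B) : L2 W →L[ℂ] L2 W :=
  (ω.map (gen cs q)).prod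

theorem wordOp_nil (cs : CoxeterSystem M W) (q : ℝ) : wordOp cs q [] = 1 := rfl

theorem wordOp_cons (cs : CoxeterSystem M W) (q : ℝ) (i : B) (ω : List B) :
    wordOp cs q (i :: ω) = gen cs q i * wordOp cs q ω := by
  simp [wordOp]

/-- The operator `T_w = T_{s_1} ⋯ T_{s_n}`, where `w = s_1 ⋯ s_n` is a reduced expression. It does
not depend on the chosen reduced expression, see `T_eq_wordOp`. -/
def T (cs : CoxeterSystem M W) (q : ℝ) (w : W) : L2 W →L[ℂ] L2 W :=
  wordOp cs q (Classical.choose (cs.exists_isReduced w))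

theorem wordOp_delta_one (cs : CoxeterSystem M W) (q : ℝ) (ω : List B) (hω : cs.IsReduced ω) :
    wordOp cs q ω (delta 1) = delta (cs.wordProd ω) := by
  induction ω with
  | nil => simp [wordOp_nil]
  | cons i ω ih =>
    have h1 : cs.IsReduced ω := by simpa using hω.drop 1
    rw [wordOp_cons, mul_apply_eq_comp, ih h1, gen_delta, if_neg, zero_smul, add_zero,
      cs.wordProd_cons]
    have h2 : cs.length (cs.simple i * cs.wordProd ω) = ω.length + 1 := by
      have := hω.eq
      rwa [cs.wordProd_cons, List.length_cons] at this
    rw [CoxeterSystem.IsLeftDescent, h2, h1.eq]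
    omega

theorem T_delta_one (cs : CoxeterSystem M W) (q : ℝ) (w : W) :
    T cs q w (delta 1) = delta w := by
  have h := Classical.choose_spec (cs.exists_isReduced w)
  rw [T, wordOp_delta_one cs q _ h.1, ← h.2]

/-- An operator commuting with all the operators `rightGen` is determined by its value at
`δ_1`. -/
theorem eq_of_delta_one (cs : CoxeterSystem M W) (q : ℝ) {x y : L2 W →L[ℂ] L2 W}
    (hx : ∀ j, x * rightGen cs q j = rightGen cs q j * x)
    (hy : ∀ j, y * rightGen cs q j = rightGen cs q j * y)
    (h : x (delta 1) = y (delta 1)) : x = y := by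
  classical
  refine clm_ext fun w => ?_
  induction hn : cs.length w generalizing w with
  | zero => rw [cs.length_eq_zero_iff.1 hn, h]
  | succ n ih =>
    have hw : w ≠ 1 := by rintro rfl; simp at hn
    obtain ⟨j, hj⟩ := cs.exists_rightDescent_of_ne_one hw
    have hv : cs.length (w * cs.simple j) = n := by
      have := cs.isRightDescent_iff.1 hj
      omega
    have hd : rightGen cs q j (delta (w * cs.simple j)) = delta w := by
      rw [rightGen_delta, if_neg (cs.isRightDescent_iff_not_isRightDescent_mul.1 hj)]
      simp
    rw [← hd, ← mul_apply_eq_comp, ← mul_apply_eq_comp, hx, hy,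
      mul_apply_eq_comp, mul_apply_eq_comp, ih _ hv]

theorem wordOp_comm (hM : M.IsRightAngled) (cs : CoxeterSystem M W) (q : ℝ) (ω : List B) (j : B) :
    wordOp cs q ω * rightGen cs q j = rightGen cs q j * wordOp cs q ω := by
  induction ω with
  | nil => simp [wordOp_nil]
  | cons i ω ih =>
    rw [wordOp_cons, mul_assoc, ih, ← mul_assoc, gen_comm_rightGen hM, mul_assoc]

theorem T_eq_wordOp (hM : M.IsRightAngled) (cs : CoxeterSystem M W) (q : ℝ) (ω : List B)
    (hω : cs.IsReduced ω) : T cs q (cs.wordProd ω) = wordOp cs q ω :=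
  eq_of_delta_one cs q (wordOp_comm hM cs q _) (wordOp_comm hM cs q _)
    (by rw [T_delta_one, wordOp_delta_one cs q ω hω])

theorem T_one (hM : M.IsRightAngled) (cs : CoxeterSystem M W) (q : ℝ) : T cs q 1 = 1 := by
  have := T_eq_wordOp hM cs q [] (by simp [CoxeterSystem.IsReduced])
  simpa [wordOp_nil] using this

theorem T_simple (hM : M.IsRightAngled) (cs : CoxeterSystem M W) (q : ℝ) (i : B) :
    T cs q (cs.simple i) = gen cs q i := by
  have := T_eq_wordOp hM cs q [i] (by simp [CoxeterSystem.IsReduced])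
  simpa [wordOp] using this

open scoped Classical in
/-- The Hecke relation `T_s T_w = T_{sw}` if `|s w| > |w|` and `T_s T_w = T_{sw} + p T_w`
otherwise. -/
theorem gen_mul_T (hM : M.IsRightAngled) (cs : CoxeterSystem M W) (q : ℝ) (i : B) (w : W) :
    gen cs q i * T cs q w =
      T cs q (cs.simple i * w) + (if cs.IsLeftDescent w i then param q else 0) • T cs q w := by
  refine eq_of_delta_one cs q ?_ ?_ ?_
  · intro j
    rw [T, mul_assoc, wordOp_comm hM, ← mul_assoc, gen_comm_rightGen hM, mul_assoc]
  · intro j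
    rw [T, T, add_mul, mul_add, smul_mul_assoc, mul_smul_comm, wordOp_comm hM, wordOp_comm hM]
  · rw [mul_apply_eq_comp, T_delta_one, gen_delta, add_apply,
      smul_apply, T_delta_one, T_delta_one]

/-- `T_w^* = T_{w⁻¹}`. -/
theorem star_T (hM : M.IsRightAngled) (cs : CoxeterSystem M W) (q : ℝ) (w : W) :
    star (T cs q w) = T cs q w⁻¹ := by
  have key : ∀ ω : List B, star (wordOp cs q ω) = wordOp cs q ω.reverse := by
    intro ω
    induction ω with
    | nil => simp [wordOp_nil]
    | cons i ω ih =>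
      rw [wordOp_cons, star_mul, ih, star_gen]
      simp [wordOp]
  obtain ⟨ω, hω, rfl⟩ := cs.exists_isReduced w
  rw [T_eq_wordOp hM cs q ω hω, key, ← cs.wordProd_reverse, T_eq_wordOp hM cs q _ hω.reverse]

/-- The `*`-algebra `A_q` generated by the operators `T_w`. -/
def heckeAlgebra (cs : CoxeterSystem M W) (q : ℝ) : StarSubalgebra ℂ (L2 W →L[ℂ] L2 W) :=
  StarAlgebra.adjoin ℂ (Set.range (T cs q))

/-- The Hecke von Neumann algebra `M_q`, generated by `A_q`. -/
def heckeVN (cs : CoxeterSystem M W) (q : ℝ) : VonNeumannAlgebra (L2 W) :=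
  OperatorSpace.bicommutant (heckeAlgebra cs q)

theorem T_mem (cs : CoxeterSystem M W) (q : ℝ) (w : W) : T cs q w ∈ heckeAlgebra cs q :=
  StarAlgebra.subset_adjoin ℂ _ ⟨w, rfl⟩

theorem T_mem_VN (cs : CoxeterSystem M W) (q : ℝ) (w : W) :
    T cs q w ∈ (heckeVN cs q).toStarSubalgebra :=
  OperatorSpace.le_bicommutant _ (T_mem cs q w)

theorem mul_mem_span (hM : M.IsRightAngled) (cs : CoxeterSystem M W) (q : ℝ)
    {x y : L2 W →L[ℂ] L2 W} (hx : x ∈ Submodule.span ℂ (Set.range (T cs q)))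
    (hy : y ∈ Submodule.span ℂ (Set.range (T cs q))) :
    x * y ∈ Submodule.span ℂ (Set.range (T cs q)) := by
  classical
  have h1 : ∀ i, ∀ y ∈ Submodule.span ℂ (Set.range (T cs q)),
      gen cs q i * y ∈ Submodule.span ℂ (Set.range (T cs q)) := by
    intro i y hy
    induction hy using Submodule.span_induction with
    | mem y hy =>
      obtain ⟨w, rfl⟩ := hy
      rw [gen_mul_T hM]
      exact add_mem (Submodule.subset_span ⟨_, rfl⟩)
        (Submodule.smul_mem _ _ (Submodule.subset_span ⟨_, rfl⟩))
    | zero => simp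
    | add a b _ _ ha hb => rw [mul_add]; exact add_mem ha hb
    | smul c a _ ha => rw [mul_smul_comm]; exact Submodule.smul_mem _ _ ha
  have h2 : ∀ ω : List B, wordOp cs q ω * y ∈ Submodule.span ℂ (Set.range (T cs q)) := by
    intro ω
    induction ω with
    | nil => simpa [wordOp_nil] using hy
    | cons i ω ih => rw [wordOp_cons, mul_assoc]; exact h1 _ _ ih
  induction hx using Submodule.span_induction with
  | mem x hx => obtain ⟨w, rfl⟩ := hx; exact h2 _
  | zero => simp
  | add a b _ _ ha hb => rw [add_mul]; exact add_mem ha hb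
  | smul c a _ ha => rw [smul_mul_assoc]; exact Submodule.smul_mem _ _ ha

theorem mem_span_T (hM : M.IsRightAngled) (cs : CoxeterSystem M W) (q : ℝ)
    {x : L2 W →L[ℂ] L2 W} (hx : x ∈ heckeAlgebra cs q) :
    x ∈ Submodule.span ℂ (Set.range (T cs q)) := by
  induction hx using StarAlgebra.adjoin_induction with
  | mem x hx => exact Submodule.subset_span hx
  | algebraMap c =>
    rw [Algebra.algebraMap_eq_smul_one, ← T_one hM cs q]
    exact Submodule.smul_mem _ _ (Submodule.subset_span ⟨_, rfl⟩)
  | add a b _ _ ha hb => exact add_mem ha hb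
  | mul a b _ _ ha hb => exact mul_mem_span hM cs q ha hb
  | star a h0 ha =>
    clear h0
    induction ha using Submodule.span_induction with
    | mem x hx =>
      obtain ⟨w, rfl⟩ := hx
      rw [star_T hM]
      exact Submodule.subset_span ⟨_, rfl⟩
    | zero => simp
    | add a b _ _ ha hb => rw [star_add]; exact add_mem ha hb
    | smul c a _ ha => rw [star_smul]; exact Submodule.smul_mem _ _ ha

/-- The operators `T_w`, `w ∈ W`, form a linear basis of `A_q`. -/
def heckeBasis (hM : M.IsRightAngled) (cs : CoxeterSystem M W) (q : ℝ) :
    Module.Basis W ℂ (heckeAlgebra cs q) :=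
  Module.Basis.mk (v := fun w => (⟨T cs q w, T_mem cs q w⟩ : heckeAlgebra cs q))
    (by
      let ev : heckeAlgebra cs q →ₗ[ℂ] L2 W :=
        { toFun := fun x => (x : L2 W →L[ℂ] L2 W) (delta 1)
          map_add' := fun x y => rfl
          map_smul' := fun c x => rfl }
      refine LinearIndependent.of_comp ev ?_
      have : (ev ∘ fun w => (⟨T cs q w, T_mem cs q w⟩ : heckeAlgebra cs q)) = delta := by
        funext w
        exact T_delta_one cs q w
      rw [this]
      exact linearIndependent_delta)
    (by
      rintro ⟨x, hx⟩ -
      have h := mem_span_T hM cs q hx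
      let ι : heckeAlgebra cs q →ₗ[ℂ] (L2 W →L[ℂ] L2 W) :=
        (heckeAlgebra cs q).toSubalgebra.toSubmodule.subtype
      have h2 : Set.range (T cs q) =
          ι '' Set.range (fun w => (⟨T cs q w, T_mem cs q w⟩ : heckeAlgebra cs q)) := by
        rw [← Set.range_comp]; rfl
      rw [h2, Submodule.span_image] at h
      obtain ⟨y, hy, hyx⟩ := h
      have : y = ⟨x, hx⟩ := Subtype.ext hyx
      rwa [← this])

theorem heckeBasis_apply (hM : M.IsRightAngled) (cs : CoxeterSystem M W) (q : ℝ) (w : W) :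
    heckeBasis hM cs q w = ⟨T cs q w, T_mem cs q w⟩ := by
  simp [heckeBasis]

open scoped Classical in
/-- The word-length cut-down `Ψ_{≤ n} : A_q → M_q`, the linear map with `T_w ↦ T_w` if `|w| ≤ n`
and `T_w ↦ 0` otherwise. -/
def cutDown (hM : M.IsRightAngled) (cs : CoxeterSystem M W) (q : ℝ) (n : ℕ) :
    heckeAlgebra cs q →ₗ[ℂ] (heckeVN cs q).toStarSubalgebra :=
  (heckeBasis hM cs q).constr ℂ fun w =>
    if cs.length w ≤ n then ⟨T cs q w, T_mem_VN cs q w⟩ else 0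

open scoped Classical in
theorem cutDown_T (hM : M.IsRightAngled) (cs : CoxeterSystem M W) (q : ℝ) (n : ℕ) (w : W) :
    cutDown hM cs q n ⟨T cs q w, T_mem cs q w⟩ =
      if cs.length w ≤ n then ⟨T cs q w, T_mem_VN cs q w⟩ else 0 := by
  rw [← heckeBasis_apply hM, cutDown, Module.Basis.constr_basis]

end algebra

end Hecke

end

/-!
The matrix coefficients `K x y = ⟨X δ_y, δ_x⟩` of `X ∈ A_q` are rigid, because `X` commutes with
the right action of the Hecke algebra: for a right descent `s` of `y`, one has
`K x y = K (xs) (ys)` if `s` is not a descent of `x`, and `K x y = K (xs) (ys) + p K x (ys)` if it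
is (`IsHeckeKernel`). Two consequences determine `K`.

* If `x` and `y` have no common right descent, then the product `x y⁻¹` is reduced, and `K x y` is
  the coefficient of `T_{x y⁻¹}` in `X` (`IsHeckeKernel.eq_of_disjoint`).
* In general `K x y` is the sum of `p ^ |u| K (x₁ u) y₁` over all ways to write `x = x₁ u v` and
  `y = y₁ u v` with lengths adding, `u` a product of commuting letters, and `x₁ u`, `y₁` without
  common descents (`IsHeckeKernel.expansion`).

Hence the cut-down `Ψ_{≤ n}` simply keeps the terms with `|x₁ u| + |y₁| ≤ n`
(`cutDown_delta_apply`). Sort these terms by the clique `u` and by the lengths and descent sets of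
`x₁ u` and of `y₁`. The part of `Ψ_{≤ n}(X)` belonging to one such choice is `∑_v L_v X R_v`, with
partial isometries `L_v`, `R_v` that are permutations of the basis followed or preceded by
coordinate projections (`cutApprox`). By the Cauchy–Schwarz inequality its completely bounded norm
is at most the largest number of `v` for which a given basis vector lies in the range of `L_v`, or
in the initial space of `R_v` (`OperatorSpace.norm_matrixOp_sum_le`, `sum_norm_projOp_sq_le`).
Such a `v` is determined by an initial segment, of prescribed length `i ≤ n`, of a given element
of `W`, and an initial segment is determined by how often each letter occurs in it; so there are
at most `(i + 1) ^ |S|` of them (`card_initialSegments_le`). The number of choices is quadratic in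
`n`, which gives a polynomial bound. The sums over `v` are infinite, but only finitely many terms
matter on finitely many coordinates (`norm_le_of_forall_finset`).

The combinatorics of descents rests on the fact that distinct descents of an element commute
(`eq_two_of_isRightDescent`), which is deduced from the cocycle `parity` of right inversions.
-/

noncomputable section

namespace Hecke

/-! ### Descents and the parity cocycle -/

section combinatorics

variable {B W : Type*} [Group W] {M : CoxeterMatrix B}

/-- Right inversions obey the cocycle rule `N(ab) = N(b) + b⁻¹ N(a) b`. -/
theorem parity_mul (hM : M.IsRightAngled) (cs : CoxeterSystem M W) (a b t : W) :
    parity hM cs (a * b) t = parity hM cs b t + parity hM cs a (b * t * b⁻¹) := by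
  rw [parity, map_mul, Equiv.Perm.mul_apply, lift_signPerm hM cs b, lift_signPerm hM cs a, zero_add]

theorem parity_mul_of_commute (hM : M.IsRightAngled) (cs : CoxeterSystem M W) {a b t : W}
    (h : t * b = b * t) :
    parity hM cs (a * b) t = parity hM cs b t + parity hM cs a t := by
  rw [parity_mul, ← h, mul_inv_cancel_right]

theorem length_mul_lt_of_parity (hM : M.IsRightAngled) (cs : CoxeterSystem M W) {a t : W}
    (h : parity hM cs a t ≠ 0) : cs.length (a * t) < cs.length a := by
  obtain ⟨ω, hω, rfl⟩ := cs.exists_isReduced a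
  exact (cs.isRightInversion_of_mem_rightInvSeq hω (mem_rightInvSeq_of_parity hM cs ω _ h)).2

theorem simple_injective (hM : M.IsRightAngled) (cs : CoxeterSystem M W) :
    Function.Injective cs.simple := by
  classical
  intro i j hij
  let f : B → Multiplicative (ZMod 2) := fun k => Multiplicative.ofAdd (if k = i then 1 else 0)
  have hsq : ∀ x : Multiplicative (ZMod 2), x * x = 1 := by decide
  have hf : M.IsLiftable f := by
    intro k l
    by_cases hkl : k = l
    · subst hkl
      rw [M.diagonal, pow_one, hsq]
    rcases hM k l hkl with h | h
    · rw [h, pow_two, hsq]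
    · rw [h, pow_zero]
  by_contra hne
  have h := congrArg (cs.lift ⟨f, hf⟩) hij
  rw [cs.lift_apply_simple, cs.lift_apply_simple] at h
  simp [f, Ne.symm hne] at h

theorem not_isRightDescent_simple (hM : M.IsRightAngled) (cs : CoxeterSystem M W) {i j : B}
    (h : i ≠ j) : ¬ cs.IsRightDescent (cs.simple i) j := by
  intro hd
  rw [CoxeterSystem.IsRightDescent, cs.length_simple, Nat.lt_one_iff, cs.length_eq_zero_iff,
    mul_eq_one_iff_eq_inv, cs.inv_simple] at hd
  exact h (simple_injective hM cs hd)

theorem simple_comm_of_eq_two (cs : CoxeterSystem M W) {i j : B} (h : M i j = 2) :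
    cs.simple i * cs.simple j = cs.simple j * cs.simple i := by
  have := cs.simple_mul_simple_pow i j
  rwa [h, pow_two, mul_eq_one_iff_eq_inv, mul_inv_rev, cs.inv_simple, cs.inv_simple] at this

/-! ### Infinite dihedral subgroups -/

open scoped Classical in
/-- For `m(i, j) = ∞`, the action of the infinite dihedral quotient of `W` on `ℤ` in which `s_i` and
`s_j` swap `0` with `-1` and with `1`; the other simple reflections act trivially. -/
def dihedralAction (i j : B) (k : B) : Equiv.Perm ℤ :=
  if k = i then Equiv.subLeft (-1) else if k = j then Equiv.subLeft 1 else 1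

theorem isLiftable_dihedralAction (hM : M.IsRightAngled) {i j : B} (hij : M i j = 0) :
    M.IsLiftable (dihedralAction i j) := by
  have hsq : ∀ k, dihedralAction i j k * dihedralAction i j k = 1 := by
    intro k
    ext x
    unfold dihedralAction
    split_ifs <;> simp
  intro k l
  by_cases hkl : k = l
  · subst hkl
    rw [M.diagonal, pow_one, hsq]
  rcases hM k l hkl with h | h
  · rw [h, pow_two]
    have h1 : dihedralAction i j k = 1 ∨ dihedralAction i j l = 1 := by
      by_contra hc
      push Not at hc
      unfold dihedralAction at hc
      have hji := M.symmetric j i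
      split_ifs at hc <;> simp_all
    rcases h1 with h1 | h1 <;> simp [h1, hsq]
  · rw [h, pow_zero]

/-- The homomorphism `W → Perm ℤ` extending `dihedralAction`. -/
def dihedralHom (hM : M.IsRightAngled) (cs : CoxeterSystem M W) {i j : B} (hij : M i j = 0) :
    W →* Equiv.Perm ℤ :=
  cs.lift ⟨_, isLiftable_dihedralAction hM hij⟩

theorem dihedralHom_wordProd_cons (hM : M.IsRightAngled) (cs : CoxeterSystem M W) {i j : B}
    (hij : M i j = 0) (k : B) (ω : List B) (x : ℤ) :
    dihedralHom hM cs hij (cs.wordProd (k :: ω)) x =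
      dihedralAction i j k (dihedralHom hM cs hij (cs.wordProd ω) x) := by
  rw [cs.wordProd_cons, map_mul, dihedralHom, cs.lift_apply_simple, Equiv.Perm.mul_apply]

/-- Each letter changes the absolute value by at most `1`. -/
theorem abs_dihedralHom_le (hM : M.IsRightAngled) (cs : CoxeterSystem M W) {i j : B}
    (hij : M i j = 0) (ω : List B) :
    |dihedralHom hM cs hij (cs.wordProd ω) 0| ≤ ω.length := by
  induction ω with
  | nil => simp
  | cons k ω ih =>
    rw [dihedralHom_wordProd_cons, List.length_cons]
    generalize dihedralHom hM cs hij (cs.wordProd ω) 0 = x at ih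
    rw [abs_le] at ih ⊢
    unfold dihedralAction
    push_cast
    split_ifs <;> simp only [Equiv.subLeft_apply, Equiv.Perm.one_apply] <;> omega

open scoped Classical in
/-- Alternating words move `0` away from itself by their length, to the left or to the right
according to their first letter. -/
theorem dihedralHom_of_isChain (hM : M.IsRightAngled) (cs : CoxeterSystem M W) {i j : B}
    (hij : M i j = 0) (ω : List B) (hω : ∀ k ∈ ω, k = i ∨ k = j) (hc : ω.IsChain (· ≠ ·)) :
    dihedralHom hM cs hij (cs.wordProd ω) 0 =
      if ω.head? = some i then -(ω.length : ℤ) else ω.length := by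
  have hne : i ≠ j := by rintro rfl; simp at hij
  induction ω with
  | nil => simp
  | cons k ω ih =>
    rw [List.isChain_cons] at hc
    rw [dihedralHom_wordProd_cons,
      ih (fun k hk => hω k (List.mem_cons_of_mem _ hk)) hc.2]
    have hk := hω k List.mem_cons_self
    cases ω with
    | nil => rcases hk with rfl | rfl <;> simp [dihedralAction, hne.symm]
    | cons l ω =>
      have hl := hω l (by simp)
      have hkl : k ≠ l := hc.1 l (by simp)
      rcases hk with rfl | rfl <;> rcases hl with rfl | rfl <;>
        simp [dihedralAction, hne, hne.symm] at hkl ⊢ <;> ring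

/-- Alternating words in two letters `i`, `j` with `m(i, j) = ∞` are reduced. -/
theorem isReduced_of_isChain (hM : M.IsRightAngled) (cs : CoxeterSystem M W) {i j : B}
    (hij : M i j = 0) (ω : List B) (hω : ∀ k ∈ ω, k = i ∨ k = j) (hc : ω.IsChain (· ≠ ·)) :
    cs.IsReduced ω := by
  refine le_antisymm (cs.length_wordProd_le ω) ?_
  obtain ⟨ω', h', he⟩ := cs.exists_isReduced (cs.wordProd ω)
  have h1 := abs_dihedralHom_le hM cs hij ω'
  rw [← he, dihedralHom_of_isChain hM cs hij ω hω hc] at h1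
  rw [he, h'.eq]
  split_ifs at h1 <;> simpa using h1

theorem exists_isChain_of_mem_closure (cs : CoxeterSystem M W) {i j : B} {b : W}
    (hb : b ∈ Subgroup.closure {cs.simple i, cs.simple j}) :
    ∃ ω : List B, (∀ k ∈ ω, k = i ∨ k = j) ∧ ω.IsChain (· ≠ ·) ∧ cs.wordProd ω = b := by
  classical
  have step : ∀ k, (k = i ∨ k = j) → ∀ y, (∃ ω : List B, (∀ k ∈ ω, k = i ∨ k = j) ∧
      ω.IsChain (· ≠ ·) ∧ cs.wordProd ω = y) → ∃ ω : List B, (∀ k ∈ ω, k = i ∨ k = j) ∧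
      ω.IsChain (· ≠ ·) ∧ cs.wordProd ω = cs.simple k * y := by
    rintro k hk _ ⟨ω, hω, hc, rfl⟩
    by_cases h : ω.head? = some k
    · obtain ⟨ω', rfl⟩ := List.head?_eq_some_iff.1 h
      exact ⟨ω', fun l hl => hω l (List.mem_cons_of_mem _ hl), (List.isChain_cons.1 hc).2,
        by simp [cs.wordProd_cons]⟩
    · refine ⟨k :: ω, ?_, List.isChain_cons.2 ⟨?_, hc⟩, cs.wordProd_cons k ω⟩
      · simpa [hk] using hω
      · rintro l hl rfl
        exact h hl
  induction hb using Subgroup.closure_induction_left with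
  | one => exact ⟨[], by simp, by simp, by simp⟩
  | mul_left x hx y _ ih =>
    rcases hx with rfl | rfl
    exacts [step i (.inl rfl) y ih, step j (.inr rfl) y ih]
  | inv_mul_cancel x hx y _ ih =>
    rcases hx with rfl | rfl
    · simpa using step i (.inl rfl) y ih
    · simpa using step j (.inr rfl) y ih

/-- Only the last letter of an alternating word is a descent. -/
theorem not_both_descents_of_mem_closure (hM : M.IsRightAngled) (cs : CoxeterSystem M W) {i j : B}
    (hij : M i j = 0) {b : W} (hb : b ∈ Subgroup.closure {cs.simple i, cs.simple j})
    (hi : cs.IsRightDescent b i) (hj : cs.IsRightDescent b j) : False := by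
  obtain ⟨ω, hω, hc, rfl⟩ := exists_isChain_of_mem_closure cs hb
  have key : ∀ k, (k = i ∨ k = j) → cs.IsRightDescent (cs.wordProd ω) k →
      ω.getLast? = some k := by
    intro k hk hd
    by_contra hl
    have h1 := isReduced_of_isChain hM cs hij ω hω hc
    have h2 := isReduced_of_isChain hM cs hij (ω ++ [k])
      (by intro l hl'; rcases List.mem_append.1 hl' with h | h
          exacts [hω l h, by simpa [List.mem_singleton.1 h] using hk])
      (by
        rw [List.isChain_append]
        refine ⟨hc, by simp, ?_⟩
        rintro l hl' m hm rfl
        simp at hm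
        subst hm
        exact hl hl')
    have h3 := h2.eq
    rw [cs.wordProd_append, cs.wordProd_singleton] at h3
    rw [CoxeterSystem.IsRightDescent, h3, h1.eq] at hd
    simp at hd
  have h := (key i (.inl rfl) hi).symm.trans (key j (.inr rfl) hj)
  rw [Option.some.injEq] at h
  subst h
  simp at hij

/-- Distinct descents commute: the element of minimal length in the coset `z⟨s_i, s_j⟩` reduces this
to elements of `⟨s_i, s_j⟩`, where, in the infinite dihedral case, only the last letter of the
alternating word is a descent. -/
theorem eq_two_of_isRightDescent (hM : M.IsRightAngled) (cs : CoxeterSystem M W) {z : W} {i j : B}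
    (hij : i ≠ j) (hi : cs.IsRightDescent z i) (hj : cs.IsRightDescent z j) : M i j = 2 := by
  classical
  refine (hM i j hij).resolve_right fun h0 => ?_
  set D := Subgroup.closure {cs.simple i, cs.simple j} with hD
  have hex : ∃ n, ∃ c ∈ D, cs.length (z * c) = n := ⟨_, 1, one_mem _, rfl⟩
  obtain ⟨c, hc, hn⟩ := Nat.find_spec hex
  have hmin : ∀ d ∈ D, cs.length (z * c) ≤ cs.length (z * d) := fun d hd =>
    hn ▸ Nat.find_min' hex ⟨d, hd, rfl⟩
  -- `z c` has no inversion in `D`, so `z` and `c⁻¹` have the same descents among `i`, `j`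
  have key : ∀ k, cs.simple k ∈ D → cs.IsRightDescent z k → cs.IsRightDescent c⁻¹ k := by
    intro k hk hd
    rw [isRightDescent_iff_parity hM] at hd ⊢
    intro h1
    have h2 := parity_mul hM cs (z * c) c⁻¹ (cs.simple k)
    rw [mul_inv_cancel_right, h1, zero_add] at h2
    rw [h2] at hd
    have h3 := length_mul_lt_of_parity hM cs hd
    rw [mul_assoc z] at h3
    exact absurd h3 (not_lt.2 (hmin _ (mul_mem hc (mul_mem (mul_mem (inv_mem hc) hk)
      (inv_mem (inv_mem hc))))))
  exact not_both_descents_of_mem_closure hM cs h0 (inv_mem hc)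
    (key i (Subgroup.subset_closure (by simp)) hi) (key j (Subgroup.subset_closure (by simp)) hj)

/-! ### Descents of products -/

theorem comm_of_isRightDescent (hM : M.IsRightAngled) (cs : CoxeterSystem M W) {z : W} {i j : B}
    (hi : cs.IsRightDescent z i) (hj : cs.IsRightDescent z j) :
    cs.simple i * cs.simple j = cs.simple j * cs.simple i := by
  by_cases hij : i = j
  · rw [hij]
  · exact simple_comm_of_eq_two cs (eq_two_of_isRightDescent hM cs hij hi hj)

/-- Right multiplication by a simple reflection does not change the other descents that commute
with it. -/
theorem isRightDescent_mul_simple_iff (hM : M.IsRightAngled) (cs : CoxeterSystem M W) (z : W)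
    {i j : B} (hij : i ≠ j) (h : cs.simple i * cs.simple j = cs.simple j * cs.simple i) :
    cs.IsRightDescent (z * cs.simple i) j ↔ cs.IsRightDescent z j := by
  have h0 := not_isRightDescent_simple hM cs hij
  rw [isRightDescent_iff_parity hM, not_not] at h0
  rw [isRightDescent_iff_parity hM, isRightDescent_iff_parity hM,
    parity_mul_of_commute hM cs h.symm, h0, zero_add]

/-- A terminal segment passes its descents on. -/
theorem isRightDescent_of_terminal (cs : CoxeterSystem M W) {x y : W} {i : B}
    (hl : cs.length (x * y) = cs.length x + cs.length y) (hy : cs.IsRightDescent y i) :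
    cs.IsRightDescent (x * y) i := by
  have h1 := cs.length_mul_le x (y * cs.simple i)
  rw [← mul_assoc] at h1
  unfold CoxeterSystem.IsRightDescent at hy ⊢
  omega

/-- A descent of `xy` (lengths adding) which is not a descent of `y` commutes with `y` and is a
descent of `x`. -/
theorem isRightDescent_of_mul (hM : M.IsRightAngled) (cs : CoxeterSystem M W) {x y : W} {i : B}
    (hl : cs.length (x * y) = cs.length x + cs.length y) (hxy : cs.IsRightDescent (x * y) i)
    (hy : ¬ cs.IsRightDescent y i) :
    cs.simple i * y = y * cs.simple i ∧ cs.IsRightDescent x i := by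
  induction hn : cs.length y generalizing y with
  | zero =>
    obtain rfl := cs.length_eq_zero_iff.1 hn
    simpa using hxy
  | succ n ih =>
    have hy1 : y ≠ 1 := by rintro rfl; simp at hn
    obtain ⟨j, hj⟩ := cs.exists_rightDescent_of_ne_one hy1
    have hji : j ≠ i := by rintro rfl; exact hy hj
    have hc := comm_of_isRightDescent hM cs (isRightDescent_of_terminal cs hl hj) hxy
    have h1 := cs.isRightDescent_iff.1 hj
    have h2 := cs.isRightDescent_iff.1 (isRightDescent_of_terminal cs hl hj)
    rw [mul_assoc] at h2
    obtain ⟨h3, h4⟩ := ih (y := y * cs.simple j) (by omega)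
      (by rwa [← mul_assoc, isRightDescent_mul_simple_iff hM cs _ hji hc])
      (by rwa [isRightDescent_mul_simple_iff hM cs _ hji hc]) (by omega)
    refine ⟨?_, h4⟩
    have h5 : cs.simple i * (y * cs.simple j) = (y * cs.simple i) * cs.simple j := by
      rw [h3, mul_assoc, hc, ← mul_assoc]
    rw [← mul_assoc] at h5
    exact mul_right_cancel h5

/-! ### Initial segments are determined by their letter counts -/

theorem isLeftDescent_of_mul (hM : M.IsRightAngled) (cs : CoxeterSystem M W) {x y : W} {i : B}
    (hl : cs.length (x * y) = cs.length x + cs.length y) (hxy : cs.IsLeftDescent (x * y) i)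
    (hx : ¬ cs.IsLeftDescent x i) :
    cs.simple i * x = x * cs.simple i ∧ cs.IsLeftDescent y i := by
  rw [← cs.isRightDescent_inv_iff] at hxy hx ⊢
  rw [mul_inv_rev] at hxy
  obtain ⟨h1, h2⟩ := isRightDescent_of_mul hM cs
    (by rw [← mul_inv_rev]; simp only [cs.length_inv]; omega) hxy hx
  refine ⟨?_, h2⟩
  have := congrArg (·⁻¹) h1
  simpa using this.symm

theorem comm_of_isLeftDescent (hM : M.IsRightAngled) (cs : CoxeterSystem M W) {z : W} {i j : B}
    (hi : cs.IsLeftDescent z i) (hj : cs.IsLeftDescent z j) :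
    cs.simple i * cs.simple j = cs.simple j * cs.simple i := by
  rw [← cs.isRightDescent_inv_iff] at hi hj
  exact comm_of_isRightDescent hM cs hi hj

theorem isLeftDescent_simple_mul_iff (hM : M.IsRightAngled) (cs : CoxeterSystem M W) (z : W)
    {i j : B} (hij : i ≠ j) (h : cs.simple i * cs.simple j = cs.simple j * cs.simple i) :
    cs.IsLeftDescent (cs.simple i * z) j ↔ cs.IsLeftDescent z j := by
  rw [← cs.isRightDescent_inv_iff, ← cs.isRightDescent_inv_iff, mul_inv_rev, cs.inv_simple,
    isRightDescent_mul_simple_iff hM cs _ hij h]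

theorem isReduced_cons_iff (cs : CoxeterSystem M W) {i : B} {ω : List B} :
    cs.IsReduced (i :: ω) ↔ cs.IsReduced ω ∧ ¬ cs.IsLeftDescent (cs.wordProd ω) i := by
  rw [cs.not_isLeftDescent_iff]
  constructor
  · intro h
    have h1 : cs.IsReduced ω := by simpa using h.drop 1
    refine ⟨h1, ?_⟩
    rw [← cs.wordProd_cons, h.eq, h1.eq, List.length_cons]
  · rintro ⟨h1, h2⟩
    rw [CoxeterSystem.IsReduced, cs.wordProd_cons, h2, h1.eq, List.length_cons]

/-- Two reduced words of the same element are permutations of each other. -/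
theorem perm_of_isReduced (hM : M.IsRightAngled) (cs : CoxeterSystem M W) {ω ω' : List B}
    (hω : cs.IsReduced ω) (hω' : cs.IsReduced ω') (h : cs.wordProd ω = cs.wordProd ω') :
    ω.Perm ω' := by
  have hlen : ω.length = ω'.length := by rw [← hω.eq, ← hω'.eq, h]
  induction hn : ω.length using Nat.strong_induction_on generalizing ω ω' with
  | _ n ih =>
  match ω, ω', hlen with
  | [], [], _ => rfl
  | i :: ω, j :: ω', hlen =>
    have h1 := (isReduced_cons_iff cs).1 hω
    have h2 := (isReduced_cons_iff cs).1 hω'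
    simp only [List.length_cons, Nat.add_right_cancel_iff] at hlen hn
    by_cases hij : i = j
    · subst hij
      refine List.Perm.cons _ (ih ω.length (by omega) h1.1 h2.1 ?_ hlen rfl)
      rw [cs.wordProd_cons, cs.wordProd_cons] at h
      exact mul_left_cancel h
    rw [cs.wordProd_cons, cs.wordProd_cons] at h
    -- both letters are left descents, so they commute and may both be moved to the front
    have hi : cs.IsLeftDescent (cs.simple i * cs.wordProd ω) i := by
      have := cs.isLeftDescent_iff_not_isLeftDescent_mul (w := cs.simple i * cs.wordProd ω) (i := i)
      simpa [h1.2] using this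
    have hj : cs.IsLeftDescent (cs.simple i * cs.wordProd ω) j := by
      rw [h]
      have := cs.isLeftDescent_iff_not_isLeftDescent_mul (w := cs.simple j * cs.wordProd ω')
        (i := j)
      simpa [h2.2] using this
    have hc := comm_of_isLeftDescent hM cs hi hj
    have hj' : cs.IsLeftDescent (cs.wordProd ω) j := by
      rwa [isLeftDescent_simple_mul_iff hM cs _ hij hc] at hj
    obtain ⟨τ, hτ, he⟩ := cs.exists_isReduced (cs.simple j * cs.wordProd ω)
    have he1 : cs.wordProd (j :: τ) = cs.wordProd ω := by
      rw [cs.wordProd_cons, ← he, cs.simple_mul_simple_cancel_left]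
    have he2 : cs.wordProd (i :: τ) = cs.wordProd ω' := by
      rw [cs.wordProd_cons, ← he, ← mul_assoc, hc, mul_assoc, h, cs.simple_mul_simple_cancel_left]
    have hl := cs.isLeftDescent_iff.1 hj'
    rw [he, hτ.eq, h1.1.eq] at hl
    have hr1 : cs.IsReduced (j :: τ) := by
      rw [CoxeterSystem.IsReduced, he1, h1.1.eq, List.length_cons, hl]
    have hr2 : cs.IsReduced (i :: τ) := by
      rw [CoxeterSystem.IsReduced, he2, h2.1.eq, List.length_cons, hl, hlen]
    have p1 := ih ω.length (by omega) h1.1 hr1 he1.symm (by simp [hl]) rfl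
    have p2 := ih ω.length (by omega) hr2 h2.1 he2 (by simp [hl, ← hlen]) (by simp [hl])
    exact (p1.cons i).trans ((List.Perm.swap j i τ).trans (p2.cons j))

open scoped Classical in
/-- The number of occurrences of the letter `i` in a reduced word of `w`. -/
def letterCount (cs : CoxeterSystem M W) (w : W) (i : B) : ℕ :=
  (Classical.choose (cs.exists_isReduced w)).count i

open scoped Classical in
theorem letterCount_wordProd (hM : M.IsRightAngled) (cs : CoxeterSystem M W) {ω : List B}
    (hω : cs.IsReduced ω) (i : B) : letterCount cs (cs.wordProd ω) i = ω.count i := by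
  have h := Classical.choose_spec (cs.exists_isReduced (cs.wordProd ω))
  exact (perm_of_isReduced hM cs h.1 hω h.2.symm).count_eq i

theorem letterCount_le_length (cs : CoxeterSystem M W) (w : W) (i : B) :
    letterCount cs w i ≤ cs.length w := by
  classical
  have h := Classical.choose_spec (cs.exists_isReduced w)
  conv_rhs => rw [h.2, h.1.eq]
  exact List.count_le_length

open scoped Classical in
theorem letterCount_simple_mul (hM : M.IsRightAngled) (cs : CoxeterSystem M W) {w : W} {j : B}
    (hw : ¬ cs.IsLeftDescent w j) (i : B) :
    letterCount cs (cs.simple j * w) i = letterCount cs w i + if j = i then 1 else 0 := by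
  obtain ⟨ω, hω, rfl⟩ := cs.exists_isReduced w
  rw [← cs.wordProd_cons, letterCount_wordProd hM cs ((isReduced_cons_iff cs).2 ⟨hω, hw⟩),
    letterCount_wordProd hM cs hω, List.count_cons]
  simp

/-- A letter that commutes with `z` and is not a descent of `z` does not occur in `z`. -/
theorem letterCount_eq_zero_of_commute (hM : M.IsRightAngled) (cs : CoxeterSystem M W) {z : W}
    {i : B} (hc : cs.simple i * z = z * cs.simple i) (hz : ¬ cs.IsLeftDescent z i) :
    letterCount cs z i = 0 := by
  induction hn : cs.length z generalizing z with
  | zero => have := letterCount_le_length cs z i; omega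
  | succ n ih =>
    have hz1 : z ≠ 1 := by rintro rfl; simp at hn
    obtain ⟨j, hj⟩ := cs.exists_leftDescent_of_ne_one hz1
    have hji : j ≠ i := by rintro rfl; exact hz hj
    have h1 := cs.isLeftDescent_iff.1 hj
    have h2 := cs.not_isLeftDescent_iff.1 hz
    have h3 : cs.IsLeftDescent (cs.simple i * z) i := by
      rw [CoxeterSystem.IsLeftDescent, cs.simple_mul_simple_cancel_left]; omega
    have h4 : cs.IsLeftDescent (cs.simple i * z) j := by
      have := cs.length_mul_le (cs.simple j * z) (cs.simple i)
      rw [cs.length_simple] at this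
      rw [CoxeterSystem.IsLeftDescent, hc, ← mul_assoc, ← hc]
      omega
    have h5 := comm_of_isLeftDescent hM cs h4 h3
    have h6 : ¬ cs.IsLeftDescent (cs.simple j * z) j :=
      cs.isLeftDescent_iff_not_isLeftDescent_mul.1 hj
    have h7 := ih (z := cs.simple j * z)
      (by rw [← mul_assoc, ← h5, mul_assoc, hc, mul_assoc])
      (by rwa [isLeftDescent_simple_mul_iff hM cs _ hji h5]) (by omega)
    have h8 := letterCount_simple_mul hM cs h6 i
    rw [cs.simple_mul_simple_cancel_left, h7, if_neg hji] at h8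
    exact h8

/-- Initial segments `z`, `z'` of `x` with the same letter counts agree: a first letter of `z` is a
left descent of `x`, and since it occurs in `z'`, it has to be a left descent of `z'` as well. -/
theorem eq_of_letterCount_eq (hM : M.IsRightAngled) (cs : CoxeterSystem M W) {x z z' : W}
    (hz : cs.length z + cs.length (z⁻¹ * x) = cs.length x)
    (hz' : cs.length z' + cs.length (z'⁻¹ * x) = cs.length x)
    (hlen : cs.length z = cs.length z')
    (h : ∀ i, letterCount cs z i = letterCount cs z' i) : z = z' := by
  induction hn : cs.length z generalizing x z z' with
  | zero =>
    rw [cs.length_eq_zero_iff.1 hn, cs.length_eq_zero_iff.1 (hlen.symm.trans hn)]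
  | succ n ih =>
    have hz1 : z ≠ 1 := by rintro rfl; simp at hn
    obtain ⟨i, hi⟩ := cs.exists_leftDescent_of_ne_one hz1
    have hi' := cs.isLeftDescent_iff_not_isLeftDescent_mul.1 hi
    have hx : cs.IsLeftDescent x i := by
      have h1 := cs.length_mul_le (cs.simple i * z) (z⁻¹ * x)
      rw [mul_assoc, mul_inv_cancel_left] at h1
      have h2 := cs.isLeftDescent_iff.1 hi
      rw [CoxeterSystem.IsLeftDescent]
      omega
    have hcount := letterCount_simple_mul hM cs hi'
    rw [cs.simple_mul_simple_cancel_left] at hcount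
    have hd : cs.IsLeftDescent z' i := by
      by_contra hd
      obtain ⟨h1, -⟩ := isLeftDescent_of_mul hM cs (x := z') (y := z'⁻¹ * x) (i := i)
        (by rw [mul_inv_cancel_left, hz']) (by rwa [mul_inv_cancel_left]) hd
      have h2 := letterCount_eq_zero_of_commute hM cs h1 hd
      have h3 := hcount i
      rw [if_pos rfl, h i] at h3
      omega
    have hd' := cs.isLeftDescent_iff_not_isLeftDescent_mul.1 hd
    have hcount' := letterCount_simple_mul hM cs hd'
    rw [cs.simple_mul_simple_cancel_left] at hcount'
    have l1 := cs.isLeftDescent_iff.1 hi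
    have l2 := cs.isLeftDescent_iff.1 hd
    have l3 := cs.isLeftDescent_iff.1 hx
    refine mul_left_cancel (ih (x := cs.simple i * x) (z := cs.simple i * z)
      (z' := cs.simple i * z') ?_ ?_ (by omega) ?_ (by omega))
    · rw [mul_inv_rev, cs.inv_simple, mul_assoc, cs.simple_mul_simple_cancel_left]; omega
    · rw [mul_inv_rev, cs.inv_simple, mul_assoc, cs.simple_mul_simple_cancel_left]; omega
    · intro j
      have h1 := hcount j
      have h2 := hcount' j
      rw [h j] at h1
      omega

/-- An element has polynomially many initial segments of a given length. -/
theorem card_initialSegments_le [Fintype B] (hM : M.IsRightAngled) (cs : CoxeterSystem M W) (x : W)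
    (n : ℕ) (S : Finset W)
    (hS : ∀ z ∈ S, cs.length z = n ∧ cs.length z + cs.length (z⁻¹ * x) = cs.length x) :
    S.card ≤ (n + 1) ^ Fintype.card B := by
  classical
  calc S.card ≤ (Fintype.piFinset fun _ : B => Finset.range (n + 1)).card := by
        refine Finset.card_le_card_of_injOn (letterCount cs) ?_ ?_
        · intro z hz
          simp only [Finset.mem_coe, Fintype.mem_piFinset, Finset.mem_range] at hz ⊢
          intro i
          have := letterCount_le_length cs z i
          rw [(hS z hz).1] at this
          omega
        · intro z hz z' hz' h
          exact eq_of_letterCount_eq hM cs (hS z hz).2 (hS z' hz').2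
            ((hS z hz).1.trans (hS z' hz').1.symm) (congrFun h)
    _ = (n + 1) ^ Fintype.card B := by simp

/-! ### Cliques and the expansion of matrix coefficients -/

/-- A finite set of letters whose simple reflections commute pairwise. -/
def IsClique (cs : CoxeterSystem M W) (U : Finset B) : Prop :=
  ∀ i ∈ U, ∀ j ∈ U, cs.simple i * cs.simple j = cs.simple j * cs.simple i

/-- The product of the simple reflections in `U`, meaningful if `U` is a clique. In general the
factors are multiplied in the order of `U.toList`. -/
def cliqueProd (cs : CoxeterSystem M W) (U : Finset B) : W := cs.wordProd U.toList

theorem length_cliqueProd_le (cs : CoxeterSystem M W) (U : Finset B) :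
    cs.length (cliqueProd cs U) ≤ U.card := by
  simpa [cliqueProd] using cs.length_wordProd_le U.toList

theorem IsClique.subset {cs : CoxeterSystem M W} {U V : Finset B} (hV : IsClique cs V)
    (h : U ⊆ V) : IsClique cs U :=
  fun i hi j hj => hV i (h hi) j (h hj)

theorem cliqueProd_empty (cs : CoxeterSystem M W) : cliqueProd cs ∅ = 1 := by
  simp [cliqueProd]

theorem cliqueProd_insert [DecidableEq B] (cs : CoxeterSystem M W) {U : Finset B} {i : B}
    (hi : i ∉ U) (hU : IsClique cs (insert i U)) :
    cliqueProd cs (insert i U) = cliqueProd cs U * cs.simple i := by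
  have h1 : ((insert i U).toList).Perm (U.toList ++ [i]) :=
    (Finset.toList_insert hi).trans (List.perm_append_singleton i _).symm
  have h2 : ((insert i U).toList.map cs.simple).Pairwise Commute := by
    rw [List.pairwise_map]
    refine List.Pairwise.imp_of_mem ?_ (List.pairwise_of_forall (R := fun _ _ => True) (by simp))
    intro a b ha hb _
    exact hU a (Finset.mem_toList.1 ha) b (Finset.mem_toList.1 hb)
  rw [cliqueProd, cliqueProd, ← cs.wordProd_singleton i, ← cs.wordProd_append]
  exact (h1.map cs.simple).prod_eq' h2

theorem cliqueProd_comm (cs : CoxeterSystem M W) {U : Finset B} {i : B}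
    (h : ∀ j ∈ U, cs.simple i * cs.simple j = cs.simple j * cs.simple i) :
    cs.simple i * cliqueProd cs U = cliqueProd cs U * cs.simple i := by
  refine (Commute.list_prod_right _ _ ?_ : Commute (cs.simple i) _)
  intro x hx
  obtain ⟨j, hj, rfl⟩ := List.mem_map.1 hx
  exact h j (Finset.mem_toList.1 hj)

theorem mem_of_isRightDescent_cliqueProd (hM : M.IsRightAngled) (cs : CoxeterSystem M W)
    {U : Finset B} (hU : IsClique cs U) (hl : cs.length (cliqueProd cs U) = U.card) {i : B}
    (hi : cs.IsRightDescent (cliqueProd cs U) i) : i ∈ U := by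
  classical
  induction U using Finset.induction_on with
  | empty => exact absurd hi (by rw [cliqueProd_empty]; exact cs.not_isRightDescent_one i)
  | insert j U hj ih =>
    by_cases hij : j = i
    · subst hij; simp
    have h1 := hU.subset (Finset.subset_insert j U)
    rw [cliqueProd_insert cs hj hU] at hi hl
    have h2 := cs.length_mul_le (cliqueProd cs U) (cs.simple j)
    have h3 := length_cliqueProd_le cs U
    rw [Finset.card_insert_of_notMem hj] at hl
    rw [cs.length_simple] at h2
    exact Finset.mem_insert_of_mem (ih h1 (by omega)
      (isRightDescent_of_mul hM cs (by rw [cs.length_simple]; omega) hi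
        (not_isRightDescent_simple hM cs hij)).2)

theorem isRightDescent_cliqueProd_of_mem (cs : CoxeterSystem M W)
    {U : Finset B} (hU : IsClique cs U) (hl : cs.length (cliqueProd cs U) = U.card) {i : B}
    (hi : i ∈ U) : cs.IsRightDescent (cliqueProd cs U) i := by
  classical
  have h0 := Finset.insert_erase hi
  have h1 := cliqueProd_insert cs (Finset.notMem_erase i U) (h0.symm ▸ hU)
  rw [h0] at h1
  have h2 := length_cliqueProd_le cs (U.erase i)
  rw [CoxeterSystem.IsRightDescent, hl, h1, mul_assoc, cs.simple_mul_simple_self, mul_one]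
  rw [Finset.card_erase_of_mem hi] at h2
  have := Finset.card_pos.2 ⟨i, hi⟩
  omega

/-- The relations satisfied by the matrix coefficients `K x y = ⟨X δ_y, δ_x⟩` of an operator `X`
commuting with the right action of the Hecke algebra with parameter `p`. -/
structure IsHeckeKernel (cs : CoxeterSystem M W) (p : ℂ) (K : W → W → ℂ) : Prop where
  both {x y : W} {i : B} (hx : cs.IsRightDescent x i) (hy : cs.IsRightDescent y i) :
    K x y = K (x * cs.simple i) (y * cs.simple i) + p * K x (y * cs.simple i)
  right {x y : W} {i : B} (hx : ¬ cs.IsRightDescent x i) (hy : cs.IsRightDescent y i) :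
    K x y = K (x * cs.simple i) (y * cs.simple i)

/-- If `x` and `y` have no common descent, then `x y⁻¹` is reduced and the coefficient at `(x, y)`
is the one at `(x y⁻¹, 1)`. -/
theorem IsHeckeKernel.eq_of_disjoint (hM : M.IsRightAngled) {cs : CoxeterSystem M W} {p : ℂ}
    {K : W → W → ℂ} (hK : IsHeckeKernel cs p K) {x y : W}
    (h : ∀ i, cs.IsRightDescent x i → ¬ cs.IsRightDescent y i) :
    cs.length (x * y⁻¹) = cs.length x + cs.length y ∧ K x y = K (x * y⁻¹) 1 := by
  induction hn : cs.length y generalizing x y with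
  | zero =>
    obtain rfl := cs.length_eq_zero_iff.1 hn
    simp
  | succ n ih =>
    have hy1 : y ≠ 1 := by rintro rfl; simp at hn
    obtain ⟨i, hi⟩ := cs.exists_rightDescent_of_ne_one hy1
    have hx : ¬ cs.IsRightDescent x i := fun hx => h i hx hi
    have l1 := cs.not_isRightDescent_iff.1 hx
    have l2 := cs.isRightDescent_iff.1 hi
    obtain ⟨h1, h2⟩ := ih (x := x * cs.simple i) (y := y * cs.simple i) (by
      intro j hj hj'
      have hij : i ≠ j := by
        rintro rfl
        exact cs.isRightDescent_iff_not_isRightDescent_mul.1 hi hj'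
      have hi' : cs.IsRightDescent (x * cs.simple i) i := by
        have := cs.isRightDescent_iff_not_isRightDescent_mul (w := x) (i := i)
        tauto
      have hc := comm_of_isRightDescent hM cs hi' hj
      rw [isRightDescent_mul_simple_iff hM cs _ hij hc] at hj hj'
      exact h j hj hj') (by omega)
    rw [mul_inv_rev, cs.inv_simple, mul_assoc, cs.simple_mul_simple_cancel_left] at h1 h2
    exact ⟨by omega, by rw [hK.right hx hi, h2]⟩

/-- The index set of the expansion of the coefficient at `(x, y)`: `x = x₁ u v` and `y = y₁ u v`
with lengths adding, `u` the product of the clique `U`, and `x₁ u`, `y₁` without common descents. -/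
structure IsCommonTail (cs : CoxeterSystem M W) (x y : W) (U : Finset B) (v : W) : Prop where
  clique : IsClique cs U
  left : cs.length (x * v⁻¹ * (cliqueProd cs U)⁻¹) + U.card + cs.length v = cs.length x
  right : cs.length (y * v⁻¹ * (cliqueProd cs U)⁻¹) + U.card + cs.length v = cs.length y
  disjoint (i : B) (h : cs.IsRightDescent (x * v⁻¹) i) :
    ¬ cs.IsRightDescent (y * v⁻¹ * (cliqueProd cs U)⁻¹) i

/-- If the length of `z = z₁ u v` adds up, then so do the lengths of all partial products. -/
theorem length_of_tail (cs : CoxeterSystem M W) {z v : W} {U : Finset B}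
    (h : cs.length (z * v⁻¹ * (cliqueProd cs U)⁻¹) + U.card + cs.length v = cs.length z) :
    cs.length (z * v⁻¹) = cs.length (z * v⁻¹ * (cliqueProd cs U)⁻¹) + U.card ∧
      cs.length (z * v⁻¹) + cs.length v = cs.length z ∧
      cs.length (cliqueProd cs U) = U.card := by
  have h1 := cs.length_mul_le (z * v⁻¹) v
  have h2 := cs.length_mul_le (z * v⁻¹ * (cliqueProd cs U)⁻¹) (cliqueProd cs U)
  have h3 := length_cliqueProd_le cs U
  rw [inv_mul_cancel_right] at h1 h2
  omega

theorem isRightDescent_of_tail (cs : CoxeterSystem M W) {z v : W} {U : Finset B}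
    (h : cs.length (z * v⁻¹ * (cliqueProd cs U)⁻¹) + U.card + cs.length v = cs.length z) {i : B}
    (hi : cs.IsRightDescent v i) : cs.IsRightDescent z i := by
  have h1 := isRightDescent_of_terminal cs (x := z * v⁻¹) (y := v) (i := i)
    (by rw [inv_mul_cancel_right]; exact (length_of_tail cs h).2.1.symm) hi
  rwa [inv_mul_cancel_right] at h1

theorem isRightDescent_of_clique_tail (cs : CoxeterSystem M W) {z v : W} {U : Finset B}
    (h : cs.length (z * v⁻¹ * (cliqueProd cs U)⁻¹) + U.card + cs.length v = cs.length z) {i : B}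
    (hi : cs.IsRightDescent (cliqueProd cs U) i) : cs.IsRightDescent (z * v⁻¹) i := by
  obtain ⟨h1, -, h2⟩ := length_of_tail cs h
  have h3 := isRightDescent_of_terminal cs (x := z * v⁻¹ * (cliqueProd cs U)⁻¹)
    (y := cliqueProd cs U) (i := i) (by rw [inv_mul_cancel_right]; omega) hi
  rwa [inv_mul_cancel_right] at h3

theorem isCommonTail_iff_of_disjoint (cs : CoxeterSystem M W) {x y : W}
    (h : ∀ i, cs.IsRightDescent x i → ¬ cs.IsRightDescent y i) (U : Finset B) (v : W) :
    IsCommonTail cs x y U v ↔ U = ∅ ∧ v = 1 := by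
  constructor
  · intro ht
    have hv : v = 1 := by
      by_contra hv
      obtain ⟨i, hi⟩ := cs.exists_rightDescent_of_ne_one hv
      exact h i (isRightDescent_of_tail cs ht.left hi) (isRightDescent_of_tail cs ht.right hi)
    refine ⟨Finset.eq_empty_of_forall_notMem fun i hi => ?_, hv⟩
    have hd := isRightDescent_cliqueProd_of_mem cs ht.clique (length_of_tail cs ht.left).2.2 hi
    have h1 := isRightDescent_of_clique_tail cs ht.left hd
    have h2 := isRightDescent_of_clique_tail cs ht.right hd
    subst hv
    rw [inv_one, mul_one] at h1 h2
    exact h i h1 h2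
  · rintro ⟨rfl, rfl⟩
    exact ⟨by simp [IsClique], by simp [cliqueProd_empty], by simp [cliqueProd_empty],
      by simpa [cliqueProd_empty] using h⟩

theorem mul_simple_mul_inv (cs : CoxeterSystem M W) (x v : W) (i : B) :
    x * cs.simple i * (v * cs.simple i)⁻¹ = x * v⁻¹ := by
  rw [mul_inv_rev, cs.inv_simple, mul_assoc, cs.simple_mul_simple_cancel_left]

/-- A common descent `i` at the end of `v` can be cancelled. -/
theorem isCommonTail_mul_simple_iff (cs : CoxeterSystem M W) {x y v : W} {i : B}
    (hx : cs.IsRightDescent x i) (hy : cs.IsRightDescent y i) (hv : cs.IsRightDescent v i)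
    (U : Finset B) :
    IsCommonTail cs (x * cs.simple i) (y * cs.simple i) U (v * cs.simple i) ↔
      IsCommonTail cs x y U v := by
  rw [cs.isRightDescent_iff] at hx hy hv
  constructor <;> intro h
  · have h1 := h.left
    have h2 := h.right
    have h3 := h.disjoint
    rw [mul_simple_mul_inv] at h1 h2 h3
    rw [mul_simple_mul_inv] at h3
    exact ⟨h.clique, by omega, by omega, h3⟩
  · refine ⟨h.clique, ?_, ?_, ?_⟩
    · rw [mul_simple_mul_inv]; have := h.left; omega
    · rw [mul_simple_mul_inv]; have := h.right; omega
    · rw [mul_simple_mul_inv, mul_simple_mul_inv]; exact h.disjoint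

/-- A common descent `i` which is not a descent of `v` belongs to the clique, and may be moved from
the clique into the first factor of `x`. -/
theorem IsCommonTail.erase [DecidableEq B] (hM : M.IsRightAngled) {cs : CoxeterSystem M W}
    {x y v : W} {i : B} {U : Finset B} (h : IsCommonTail cs x y U v)
    (hx : cs.IsRightDescent x i) (hy : cs.IsRightDescent y i) (hv : ¬ cs.IsRightDescent v i) :
    i ∈ U ∧ IsCommonTail cs x (y * cs.simple i) (U.erase i) v ∧
      y * cs.simple i * v⁻¹ * (cliqueProd cs (U.erase i))⁻¹ =
        y * v⁻¹ * (cliqueProd cs U)⁻¹ := by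
  obtain ⟨a1, a2, a3⟩ := length_of_tail cs h.left
  obtain ⟨b1, b2, -⟩ := length_of_tail cs h.right
  obtain ⟨hc, hxi⟩ := isRightDescent_of_mul hM cs (x := x * v⁻¹) (y := v) (i := i)
    (by rw [inv_mul_cancel_right]; omega) (by rwa [inv_mul_cancel_right]) hv
  obtain ⟨-, hyi⟩ := isRightDescent_of_mul hM cs (x := y * v⁻¹) (y := v) (i := i)
    (by rw [inv_mul_cancel_right]; omega) (by rwa [inv_mul_cancel_right]) hv
  have hU : i ∈ U := by
    by_contra hU
    have h1 : ¬ cs.IsRightDescent (cliqueProd cs U) i := fun h' =>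
      hU (mem_of_isRightDescent_cliqueProd hM cs h.clique a3 h')
    obtain ⟨-, h2⟩ := isRightDescent_of_mul hM cs (x := y * v⁻¹ * (cliqueProd cs U)⁻¹)
      (y := cliqueProd cs U) (i := i)
      (by rw [inv_mul_cancel_right]; omega) (by rwa [inv_mul_cancel_right]) h1
    exact h.disjoint i hxi h2
  have hins := Finset.insert_erase hU
  have hu := cliqueProd_insert cs (Finset.notMem_erase i U) (hins.symm ▸ h.clique)
  have hu' := cliqueProd_comm cs (U := U.erase i) (i := i)
    fun j hj => h.clique i hU j (Finset.mem_of_mem_erase hj)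
  rw [hins] at hu
  have hcard : (U.erase i).card + 1 = U.card := Finset.card_erase_add_one hU
  have hvi : cs.simple i * v⁻¹ = v⁻¹ * cs.simple i := by
    have := congrArg (·⁻¹) hc
    simpa using this.symm
  have hx' : x * v⁻¹ * (cliqueProd cs (U.erase i))⁻¹ =
      x * v⁻¹ * (cliqueProd cs U)⁻¹ * cs.simple i := by
    rw [hu, ← hu', mul_inv_rev, cs.inv_simple]
    simp only [mul_assoc, cs.simple_mul_simple_self, mul_one]
  have hy' : y * cs.simple i * v⁻¹ * (cliqueProd cs (U.erase i))⁻¹ =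
      y * v⁻¹ * (cliqueProd cs U)⁻¹ := by
    rw [hu, mul_inv_rev, cs.inv_simple, mul_assoc y, hvi]
    simp only [mul_assoc]
  refine ⟨hU, ⟨h.clique.subset (Finset.erase_subset _ _), ?_, ?_, ?_⟩, hy'⟩
  · have h1 := cs.length_mul_le (x * v⁻¹ * (cliqueProd cs U)⁻¹) (cs.simple i)
    have h2 := cs.length_mul_le (x * v⁻¹ * (cliqueProd cs (U.erase i))⁻¹)
      (cliqueProd cs (U.erase i))
    have h3 := length_cliqueProd_le cs (U.erase i)
    rw [cs.length_simple, ← hx'] at h1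
    rw [inv_mul_cancel_right] at h2
    omega
  · rw [hy']
    have := cs.isRightDescent_iff.1 hy
    omega
  · rw [hy']
    exact h.disjoint

/-- The inverse of the move in `IsCommonTail.erase`. -/
theorem IsCommonTail.insert [DecidableEq B] (hM : M.IsRightAngled) {cs : CoxeterSystem M W}
    {x y v : W} {i : B} {U : Finset B} (h : IsCommonTail cs x (y * cs.simple i) U v)
    (hx : cs.IsRightDescent x i) (hy : cs.IsRightDescent y i) :
    i ∉ U ∧ ¬ cs.IsRightDescent v i ∧ IsCommonTail cs x y (insert i U) v := by
  obtain ⟨a1, a2, a3⟩ := length_of_tail cs h.left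
  obtain ⟨b1, b2, -⟩ := length_of_tail cs h.right
  have hyi := cs.isRightDescent_iff_not_isRightDescent_mul.1 hy
  have hv : ¬ cs.IsRightDescent v i := fun hv => hyi (isRightDescent_of_tail cs h.right hv)
  obtain ⟨hc, hxi⟩ := isRightDescent_of_mul hM cs (x := x * v⁻¹) (y := v) (i := i)
    (by rw [inv_mul_cancel_right]; omega) (by rwa [inv_mul_cancel_right]) hv
  have hui : ¬ cs.IsRightDescent (cliqueProd cs U) i := by
    intro hui
    have h1 := isRightDescent_of_clique_tail cs h.right hui
    rw [isRightDescent_iff_parity hM] at h1 hyi hv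
    have h2 := parity_mul_of_commute hM cs (a := y * cs.simple i * v⁻¹) hc
    rw [inv_mul_cancel_right, not_not.1 hv, zero_add] at h2
    rw [h2] at hyi
    exact hyi h1
  have hU : i ∉ U := fun hU => hui (isRightDescent_cliqueProd_of_mem cs h.clique a3 hU)
  obtain ⟨hcu, hx1⟩ := isRightDescent_of_mul hM cs (x := x * v⁻¹ * (cliqueProd cs U)⁻¹)
    (y := cliqueProd cs U) (i := i)
    (by rw [inv_mul_cancel_right]; omega) (by rwa [inv_mul_cancel_right]) hui
  -- all letters of the clique and `i` are descents of `x v⁻¹`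
  have hcl : ∀ j ∈ U, cs.simple i * cs.simple j = cs.simple j * cs.simple i := fun j hj =>
    comm_of_isRightDescent hM cs hxi (isRightDescent_of_clique_tail cs h.left
      (isRightDescent_cliqueProd_of_mem cs h.clique a3 hj))
  have hclique : IsClique cs (Insert.insert i U) := by
    intro j hj k hk
    rcases Finset.mem_insert.1 hj with h1 | h1 <;> rcases Finset.mem_insert.1 hk with h2 | h2
    exacts [by rw [h1, h2], by rw [h1]; exact hcl k h2, by rw [h2]; exact (hcl j h1).symm,
      h.clique j h1 k h2]
  have hu := cliqueProd_insert cs hU hclique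
  have hcard := Finset.card_insert_of_notMem hU
  have hvi : cs.simple i * v⁻¹ = v⁻¹ * cs.simple i := by
    have := congrArg (·⁻¹) hc
    simpa using this.symm
  have hx' : x * v⁻¹ * (cliqueProd cs (Insert.insert i U))⁻¹ =
      x * v⁻¹ * (cliqueProd cs U)⁻¹ * cs.simple i := by
    rw [hu, ← hcu, mul_inv_rev, cs.inv_simple, mul_assoc _ _ (cs.simple i)]
  have hy' : y * v⁻¹ * (cliqueProd cs (Insert.insert i U))⁻¹ =
      y * cs.simple i * v⁻¹ * (cliqueProd cs U)⁻¹ := by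
    rw [hu, mul_inv_rev, cs.inv_simple, mul_assoc y (cs.simple i), hvi]
    simp only [mul_assoc]
  refine ⟨hU, hv, hclique, ?_, ?_, ?_⟩
  · rw [hx', hcard]
    have := cs.isRightDescent_iff.1 hx1
    omega
  · rw [hy', hcard]
    have := cs.isRightDescent_iff.1 hy
    omega
  · rw [hy']
    exact h.disjoint

open scoped Classical in
/-- A Hecke kernel is determined by its values at the pairs without common descents: each
coefficient is a sum over the common tails `u v` of `x` and `y`, where the letters of the clique `u`
contribute the diagonal parts `p` of the generators. -/
theorem IsHeckeKernel.expansion [Fintype B] (hM : M.IsRightAngled) {cs : CoxeterSystem M W} {p : ℂ}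
    {K : W → W → ℂ} (hK : IsHeckeKernel cs p K) (V : Finset W) (x y : W)
    (hV : ∀ v, cs.length v ≤ cs.length x → v ∈ V) :
    K x y = ∑ α ∈ (Finset.univ ×ˢ V).filter (fun α => IsCommonTail cs x y α.1 α.2),
      p ^ α.1.card * K (x * α.2⁻¹) (y * α.2⁻¹ * (cliqueProd cs α.1)⁻¹) := by
  induction hn : cs.length y using Nat.strong_induction_on generalizing x y with
  | _ n ih =>
  by_cases hd : ∀ i, cs.IsRightDescent x i → ¬ cs.IsRightDescent y i
  · have : (Finset.univ ×ˢ V).filter (fun α => IsCommonTail cs x y α.1 α.2) =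
        {((∅ : Finset B), (1 : W))} := by
      ext ⟨U, v⟩
      rw [Finset.mem_filter, isCommonTail_iff_of_disjoint cs hd, Finset.mem_singleton,
        Prod.mk.injEq, and_iff_right_iff_imp]
      rintro ⟨rfl, rfl⟩
      simp [hV 1 (by simp)]
    rw [this, Finset.sum_singleton]
    simp [cliqueProd_empty]
  push Not at hd
  obtain ⟨i, hx, hy⟩ := hd
  have lx := cs.isRightDescent_iff.1 hx
  have ly := cs.isRightDescent_iff.1 hy
  rw [hK.both hx hy,
    ih _ (by omega) (x * cs.simple i) (y * cs.simple i) (fun v hv => hV v (by omega)) rfl,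
    ih _ (by omega) x (y * cs.simple i) hV rfl, Finset.mul_sum,
    ← Finset.sum_filter_add_sum_filter_not
      ((Finset.univ ×ˢ V).filter fun α => IsCommonTail cs x y α.1 α.2)
      (fun α => cs.IsRightDescent α.2 i)]
  congr 1
  · refine (Finset.sum_nbij' (fun α => (α.1, α.2 * cs.simple i))
      (fun α => (α.1, α.2 * cs.simple i)) ?_ ?_ ?_ ?_ ?_).symm
    · rintro ⟨U, v⟩ h
      simp only [Finset.mem_filter, Finset.mem_product, Finset.mem_univ, true_and] at h ⊢
      obtain ⟨⟨-, h1⟩, h2⟩ := h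
      refine ⟨hV _ ?_, (isCommonTail_mul_simple_iff cs hx hy h2 U).2 h1⟩
      have := cs.isRightDescent_iff.1 h2
      have := (length_of_tail cs h1.left).2.1
      omega
    · rintro ⟨U, v⟩ h
      simp only [Finset.mem_filter, Finset.mem_product, Finset.mem_univ, true_and] at h ⊢
      obtain ⟨-, h1⟩ := h
      have h2 : ¬ cs.IsRightDescent v i := fun h2 =>
        cs.isRightDescent_iff_not_isRightDescent_mul.1 hx (isRightDescent_of_tail cs h1.left h2)
      have h3 : cs.IsRightDescent (v * cs.simple i) i := by
        have := cs.isRightDescent_iff_not_isRightDescent_mul (w := v) (i := i)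
        tauto
      have h4 := (isCommonTail_mul_simple_iff cs hx hy h3 U).1
        (by rwa [cs.simple_mul_simple_cancel_right])
      have := (length_of_tail cs h4.left).2.1
      exact ⟨⟨hV _ (by omega), h4⟩, h3⟩
    · rintro ⟨U, v⟩ -
      simp
    · rintro ⟨U, v⟩ -
      simp
    · rintro ⟨U, v⟩ -
      simp only [mul_simple_mul_inv]
  · refine (Finset.sum_nbij' (fun α => (α.1.erase i, α.2))
      (fun α => (Insert.insert i α.1, α.2)) ?_ ?_ ?_ ?_ ?_).symm
    · rintro ⟨U, v⟩ h
      simp only [Finset.mem_filter, Finset.mem_product, Finset.mem_univ, true_and] at h ⊢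
      exact ⟨h.1.1, (h.1.2.erase hM hx hy h.2).2.1⟩
    · rintro ⟨U, v⟩ h
      simp only [Finset.mem_filter, Finset.mem_product, Finset.mem_univ, true_and] at h ⊢
      obtain ⟨-, h2, h3⟩ := h.2.insert hM hx hy
      exact ⟨⟨h.1, h3⟩, h2⟩
    · rintro ⟨U, v⟩ h
      simp only [Finset.mem_filter, Finset.mem_product, Finset.mem_univ, true_and] at h ⊢
      rw [Finset.insert_erase (h.1.2.erase hM hx hy h.2).1]
    · rintro ⟨U, v⟩ h
      simp only [Finset.mem_filter, Finset.mem_product, Finset.mem_univ, true_and] at h ⊢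
      rw [Finset.erase_insert (h.2.insert hM hx hy).1]
    · rintro ⟨U, v⟩ h
      simp only [Finset.mem_filter, Finset.mem_product, Finset.mem_univ, true_and] at h ⊢
      obtain ⟨h1, -, h3⟩ := h.1.2.erase hM hx hy h.2
      rw [h3, ← Finset.card_erase_add_one h1, pow_succ]
      ring

end combinatorics

end Hecke

namespace OperatorSpace

/-! ### Norm estimates for matrices of operators -/

section

variable {H : Type*} [NormedAddCommGroup H] [InnerProductSpace ℂ H] {k : ℕ}

/-- The operator `R ⊕ ⋯ ⊕ R` applied to a vector of `H ⊕ ⋯ ⊕ H`. -/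
def diagApply (R : H →L[ℂ] H) (ξ : PiLp 2 (fun _ : Fin k => H)) : PiLp 2 (fun _ : Fin k => H) :=
  WithLp.toLp 2 fun i => R (ξ i)

theorem sum_norm_diagApply_sq_le {ι : Type*} (s : Finset ι) (R : ι → H →L[ℂ] H) {C : ℝ}
    (h : ∀ ξ, ∑ v ∈ s, ‖R v ξ‖ ^ 2 ≤ C * ‖ξ‖ ^ 2) (ξ : PiLp 2 (fun _ : Fin k => H)) :
    ∑ v ∈ s, ‖diagApply (R v) ξ‖ ^ 2 ≤ C * ‖ξ‖ ^ 2 := by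
  simp only [PiLp.norm_sq_eq_of_L2]
  rw [Finset.sum_comm, Finset.mul_sum]
  exact Finset.sum_le_sum fun i _ => h (ξ i)

/-- The map `x ↦ ∑ L_v x R_v` has completely bounded norm at most `C` if the row `(L_v)` and the
column `(R_v)` have norm at most `√C`. -/
theorem norm_matrixOp_sum_le [CompleteSpace H] {ι : Type*} (s : Finset ι) (L R : ι → H →L[ℂ] H)
    {C : ℝ} (hC : 0 ≤ C) (hL : ∀ ξ, ∑ v ∈ s, ‖star (L v) ξ‖ ^ 2 ≤ C * ‖ξ‖ ^ 2)
    (hR : ∀ ξ, ∑ v ∈ s, ‖R v ξ‖ ^ 2 ≤ C * ‖ξ‖ ^ 2) (x : Matrix (Fin k) (Fin k) (H →L[ℂ] H)) :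
    ‖matrixOp (x.map fun a => ∑ v ∈ s, L v * a * R v)‖ ≤ C * ‖matrixOp x‖ := by
  set S := matrixOp (x.map fun a => ∑ v ∈ s, L v * a * R v) with hS
  have hinner : ∀ η ξ, ⟪η, S ξ⟫_ℂ =
      ∑ v ∈ s, ⟪diagApply (star (L v)) η, matrixOp x (diagApply (R v) ξ)⟫_ℂ := by
    intro η ξ
    simp only [PiLp.inner_apply, matrixOp_apply, hS, diagApply, Matrix.map_apply]
    rw [Finset.sum_comm]
    refine Finset.sum_congr rfl fun a _ => ?_
    simp only [ContinuousLinearMap.star_eq_adjoint, ContinuousLinearMap.adjoint_inner_left]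
    rw [← inner_sum]
    congr 1
    simp only [map_sum, sum_apply]
    rw [Finset.sum_comm]
    rfl
  have hbound : ∀ η ξ, ‖⟪η, S ξ⟫_ℂ‖ ≤ C * ‖matrixOp x‖ * ‖ξ‖ * ‖η‖ := by
    intro η ξ
    rw [hinner]
    calc ‖∑ v ∈ s, ⟪diagApply (star (L v)) η, matrixOp x (diagApply (R v) ξ)⟫_ℂ‖
        ≤ ∑ v ∈ s, ‖matrixOp x‖ * (‖diagApply (star (L v)) η‖ * ‖diagApply (R v) ξ‖) := by
          refine norm_sum_le_of_le _ fun v _ => (norm_inner_le_norm _ _).trans ?_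
          have := (matrixOp x).le_opNorm (diagApply (R v) ξ)
          have h0 := norm_nonneg (diagApply (star (L v)) η)
          nlinarith
      _ = ‖matrixOp x‖ * ∑ v ∈ s, ‖diagApply (star (L v)) η‖ * ‖diagApply (R v) ξ‖ :=
          (Finset.mul_sum _ _ _).symm
      _ ≤ ‖matrixOp x‖ * (√(∑ v ∈ s, ‖diagApply (star (L v)) η‖ ^ 2) *
            √(∑ v ∈ s, ‖diagApply (R v) ξ‖ ^ 2)) := by
          gcongr
          exact Real.sum_mul_le_sqrt_mul_sqrt _ _ _
      _ ≤ ‖matrixOp x‖ * (√(C * ‖η‖ ^ 2) * √(C * ‖ξ‖ ^ 2)) := by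
          gcongr
          · exact sum_norm_diagApply_sq_le s _ hL η
          · exact sum_norm_diagApply_sq_le s _ hR ξ
      _ = C * ‖matrixOp x‖ * ‖ξ‖ * ‖η‖ := by
          rw [Real.sqrt_mul hC, Real.sqrt_mul hC, Real.sqrt_sq (norm_nonneg _),
            Real.sqrt_sq (norm_nonneg _)]
          linear_combination ‖matrixOp x‖ * ‖ξ‖ * ‖η‖ * Real.mul_self_sqrt hC
  refine ContinuousLinearMap.opNorm_le_bound _ (by positivity) fun ξ => ?_
  have h := hbound (S ξ) ξ
  rw [inner_self_eq_norm_sq_to_K] at h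
  norm_num at h
  rcases (norm_nonneg (S ξ)).eq_or_lt' with h0 | h0
  · rw [h0]; positivity
  · rw [pow_two] at h
    exact le_of_mul_le_mul_right h h0

theorem matrixOp_sum_smul {β : Type*} (s : Finset β) (c : β → ℂ)
    (g : β → (H →L[ℂ] H) → (H →L[ℂ] H)) (x : Matrix (Fin k) (Fin k) (H →L[ℂ] H)) :
    matrixOp (x.map fun a => ∑ b ∈ s, c b • g b a) = ∑ b ∈ s, c b • matrixOp (x.map (g b)) := by
  ext ξ i : 2
  rw [matrixOp_apply, sum_apply, WithLp.ofLp_sum, Finset.sum_apply]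
  simp only [Matrix.map_apply, sum_apply, smul_apply,
    PiLp.smul_apply, matrixOp_apply, Finset.smul_sum]
  exact Finset.sum_comm

end

end OperatorSpace

namespace Hecke

section l2

variable {X : Type*}

theorem sum_apply_apply {ι : Type*} (s : Finset ι) (f : ι → L2 X) (x : X) :
    (∑ i ∈ s, f i : L2 X) x = ∑ i ∈ s, f i x := by
  rw [lp.coeFn_sum, Finset.sum_apply]

theorem norm_sq_eq_tsum (f : L2 X) : ‖f‖ ^ 2 = ∑' x, ‖f x‖ ^ 2 := by
  have h := lp.norm_rpow_eq_tsum (p := 2) (by norm_num) f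
  simpa using h

theorem summable_norm_sq (f : L2 X) : Summable fun x => ‖f x‖ ^ 2 := by
  have h := (lp.memℓp f).summable (p := 2) (by norm_num)
  simpa using h

theorem norm_permOp_le (e : Equiv.Perm X) : ‖permOp e‖ ≤ 1 :=
  LinearMap.mkContinuous_norm_le _ zero_le_one _

/-- Coordinate projections under which every point is covered at most `N` times form a column of
norm at most `√N`. -/
theorem sum_norm_projOp_sq_le {ι : Type*} (s : Finset ι) (D : ι → Set X) {N : ℝ}
    (hN : ∀ x, ∀ t ⊆ s, (∀ v ∈ t, x ∈ D v) → (t.card : ℝ) ≤ N) (f : L2 X) :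
    ∑ v ∈ s, ‖projOp (D v) f‖ ^ 2 ≤ N * ‖f‖ ^ 2 := by
  classical
  simp only [norm_sq_eq_tsum]
  rw [← Summable.tsum_finsetSum fun v _ => summable_norm_sq (projOp (D v) f), ← tsum_mul_left]
  refine Summable.tsum_le_tsum (fun x => ?_)
    (summable_sum fun v _ => summable_norm_sq (projOp (D v) f)) ((summable_norm_sq f).mul_left N)
  have h : ∀ v, ‖projOp (D v) f x‖ ^ 2 = if x ∈ D v then ‖f x‖ ^ 2 else 0 := by
    intro v
    rw [projOp_apply]
    split_ifs <;> simp
  simp only [h]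
  rw [← Finset.sum_filter, Finset.sum_const, nsmul_eq_mul]
  gcongr
  exact hN x _ (Finset.filter_subset _ _) (by simp)

/-- The norm of an operator is controlled by operators agreeing with it on finitely many
coordinates. -/
theorem norm_le_of_forall_finset {k : ℕ}
    (S : PiLp 2 (fun _ : Fin k => L2 X) →L[ℂ] PiLp 2 (fun _ : Fin k => L2 X)) {C : ℝ} (hC : 0 ≤ C)
    (h : ∀ F : Finset X, ∃ S' : PiLp 2 (fun _ : Fin k => L2 X) →L[ℂ]
      PiLp 2 (fun _ : Fin k => L2 X), ‖S'‖ ≤ C ∧ ∀ ξ i, ∀ x ∈ F, S ξ i x = S' ξ i x) : ‖S‖ ≤ C := by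
  refine S.opNorm_le_bound hC fun ξ => ?_
  refine le_of_sq_le_sq ?_ (by positivity)
  rw [PiLp.norm_sq_eq_of_L2]
  simp only [norm_sq_eq_tsum]
  rw [← Summable.tsum_finsetSum fun i _ => summable_norm_sq (S ξ i)]
  refine (summable_sum fun i _ => summable_norm_sq (S ξ i)).tsum_le_of_sum_le fun F => ?_
  obtain ⟨S', hS', he⟩ := h F
  calc ∑ x ∈ F, ∑ i, ‖S ξ i x‖ ^ 2 = ∑ i, ∑ x ∈ F, ‖S' ξ i x‖ ^ 2 := by
        rw [Finset.sum_comm]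
        exact Finset.sum_congr rfl fun i _ => Finset.sum_congr rfl fun x hx => by rw [he ξ i x hx]
    _ ≤ ∑ i, ‖S' ξ i‖ ^ 2 := by
        refine Finset.sum_le_sum fun i _ => ?_
        rw [norm_sq_eq_tsum]
        exact (summable_norm_sq (S' ξ i)).sum_le_tsum F fun _ _ => by positivity
    _ = ‖S' ξ‖ ^ 2 := (PiLp.norm_sq_eq_of_L2 _ _).symm
    _ ≤ (C * ‖ξ‖) ^ 2 := by
        gcongr
        exact S'.le_of_opNorm_le hS' ξ

end l2

end Hecke

namespace Hecke

section cutdown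

variable {B W : Type*} [Group W] {M : CoxeterMatrix B}

/-! ### The kernel of the length cut-down -/

open scoped Classical in
theorem rightGen_apply (cs : CoxeterSystem M W) (q : ℝ) (i : B) (f : L2 W) (x : W) :
    rightGen cs q i f x =
      f (x * cs.simple i) + (if cs.IsRightDescent x i then param q else 0) * f x := by
  change permOp (Equiv.mulRight (cs.simple i)) f x +
    param q * projOp {w | cs.IsRightDescent w i} f x = _
  rw [permOp_apply, projOp_apply]
  simp

theorem isHeckeKernel_of_commute (cs : CoxeterSystem M W) (q : ℝ)
    {X : L2 W →L[ℂ] L2 W} (hX : ∀ j, X * rightGen cs q j = rightGen cs q j * X) :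
    IsHeckeKernel cs (param q) fun x y => X (delta y) x := by
  classical
  have key : ∀ {y i}, cs.IsRightDescent y i →
      X (delta y) = rightGen cs q i (X (delta (y * cs.simple i))) := by
    intro y i hy
    have h := cs.isRightDescent_iff_not_isRightDescent_mul.1 hy
    rw [← mul_apply_eq_comp, ← hX, mul_apply_eq_comp, rightGen_delta, if_neg h]
    simp
  constructor
  · intro x y i hx hy
    rw [key hy, rightGen_apply, if_pos hx]
  · intro x y i hx hy
    rw [key hy, rightGen_apply, if_neg hx, zero_mul, add_zero]

theorem isHeckeKernel_T (hM : M.IsRightAngled) (cs : CoxeterSystem M W) (q : ℝ) (w : W) :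
    IsHeckeKernel cs (param q) fun x y => T cs q w (delta y) x :=
  isHeckeKernel_of_commute cs q fun j => by rw [T, wordOp_comm hM]

open scoped Classical in
/-- The cut-down restricts the expansion of `IsHeckeKernel.expansion` to the terms whose reduced
part has length at most `n`. -/
theorem cutDown_delta_apply [Fintype B] (hM : M.IsRightAngled)
    (cs : CoxeterSystem M W) (q : ℝ) (n : ℕ) (X : heckeAlgebra cs q) (V : Finset W) (x y : W)
    (hV : ∀ v, cs.length v ≤ cs.length x → v ∈ V) :
    (cutDown hM cs q n X : L2 W →L[ℂ] L2 W) (delta y) x =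
      ∑ α ∈ (Finset.univ ×ˢ V).filter (fun α => IsCommonTail cs x y α.1 α.2 ∧
          cs.length (x * α.2⁻¹) + cs.length (y * α.2⁻¹ * (cliqueProd cs α.1)⁻¹) ≤ n),
        param q ^ α.1.card *
          (X : L2 W →L[ℂ] L2 W) (delta (y * α.2⁻¹ * (cliqueProd cs α.1)⁻¹)) (x * α.2⁻¹) := by
  let ev (u v : W) : heckeAlgebra cs q →ₗ[ℂ] ℂ :=
    { toFun := fun X => (X : L2 W →L[ℂ] L2 W) (delta v) u
      map_add' := fun _ _ => rfl
      map_smul' := fun _ _ => rfl }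
  let lhs : heckeAlgebra cs q →ₗ[ℂ] ℂ :=
    { toFun := fun X => (cutDown hM cs q n X : L2 W →L[ℂ] L2 W) (delta y) x
      map_add' := fun X Y => by rw [map_add]; rfl
      map_smul' := fun c X => by rw [map_smul]; rfl }
  let rhs : heckeAlgebra cs q →ₗ[ℂ] ℂ :=
    ∑ α ∈ (Finset.univ ×ˢ V).filter (fun α => IsCommonTail cs x y α.1 α.2 ∧
        cs.length (x * α.2⁻¹) + cs.length (y * α.2⁻¹ * (cliqueProd cs α.1)⁻¹) ≤ n),
      param q ^ α.1.card • ev (x * α.2⁻¹) (y * α.2⁻¹ * (cliqueProd cs α.1)⁻¹)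
  have hlr : lhs = rhs := by
    refine (heckeBasis hM cs q).ext fun w => ?_
    rw [heckeBasis_apply]
    have hK := isHeckeKernel_T hM cs q w
    have hL : lhs ⟨T cs q w, T_mem cs q w⟩ =
        if cs.length w ≤ n then T cs q w (delta y) x else 0 := by
      change (cutDown hM cs q n ⟨T cs q w, T_mem cs q w⟩ : L2 W →L[ℂ] L2 W) (delta y) x = _
      rw [cutDown_T]
      split_ifs <;> rfl
    have hR : rhs ⟨T cs q w, T_mem cs q w⟩ =
        ∑ α ∈ (Finset.univ ×ˢ V).filter (fun α => IsCommonTail cs x y α.1 α.2 ∧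
          cs.length (x * α.2⁻¹) + cs.length (y * α.2⁻¹ * (cliqueProd cs α.1)⁻¹) ≤ n),
        param q ^ α.1.card * T cs q w (delta (y * α.2⁻¹ * (cliqueProd cs α.1)⁻¹)) (x * α.2⁻¹) := by
      simp only [rhs, LinearMap.sum_apply, LinearMap.smul_apply, smul_eq_mul]
      rfl
    -- a nonzero term of the expansion for `T_w` comes from a pair `(x₁ u, y₁)` with
    -- `w = x₁ u y₁⁻¹` reduced
    have hlen : ∀ α : Finset B × W, IsCommonTail cs x y α.1 α.2 →
        T cs q w (delta (y * α.2⁻¹ * (cliqueProd cs α.1)⁻¹)) (x * α.2⁻¹) ≠ 0 →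
        cs.length (x * α.2⁻¹) + cs.length (y * α.2⁻¹ * (cliqueProd cs α.1)⁻¹) = cs.length w := by
      intro α hα h0
      obtain ⟨h1, h2⟩ := hK.eq_of_disjoint hM hα.disjoint
      rw [h2, T_delta_one] at h0
      rw [← h1]
      congr 1
      by_contra hne
      exact h0 (delta_apply_ne hne)
    rw [hL, hR]
    split_ifs with hw
    · rw [hK.expansion hM V x y hV]
      refine (Finset.sum_subset ?_ ?_).symm
      · intro α
        simp only [Finset.mem_filter]
        tauto
      · intro α h1 h2
        simp only [Finset.mem_filter, not_and] at h1 h2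
        by_contra h0
        exact h2 h1.1 h1.2 ((hlen α h1.2 (right_ne_zero_of_mul h0)).le.trans hw)
    · refine (Finset.sum_eq_zero fun α hα => ?_).symm
      simp only [Finset.mem_filter] at hα
      by_contra h0
      have := hlen α hα.2.1 (right_ne_zero_of_mul h0)
      omega
  have h := congrArg (fun f => f X) hlr
  change (cutDown hM cs q n X : L2 W →L[ℂ] L2 W) (delta y) x = rhs X at h
  rw [h]
  simp only [rhs, LinearMap.sum_apply, LinearMap.smul_apply, smul_eq_mul]
  rfl

/-! ### The cut-down as a sum of elementary completely bounded maps -/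

open scoped Classical in
/-- The length and the set of right descents of `z`. -/
def descentType [Fintype B] (cs : CoxeterSystem M W) (z : W) : ℕ × Finset B :=
  (cs.length z, Finset.univ.filter fun i => cs.IsRightDescent z i)

open scoped Classical in
/-- The pairs of types `(a, b)` for which `x y⁻¹` is reduced of length at most `n` whenever `x` has
type `a` and `y` has type `b`. -/
def typePairs (B : Type*) [Fintype B] (n : ℕ) : Finset ((ℕ × Finset B) × (ℕ × Finset B)) :=
  ((Finset.range (n + 1) ×ˢ Finset.univ) ×ˢ (Finset.range (n + 1) ×ˢ Finset.univ)).filter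
    fun c : (ℕ × Finset B) × (ℕ × Finset B) => c.1.1 + c.2.1 ≤ n ∧ Disjoint c.1.2 c.2.2

theorem card_typePairs_le [Fintype B] (n : ℕ) :
    (typePairs B n).card ≤ ((n + 1) * 2 ^ Fintype.card B) ^ 2 := by
  classical
  refine (Finset.card_filter_le _ _).trans ?_
  simp [Finset.card_product, pow_two]

/-- The elements `x = x₁ u v` (lengths adding) such that `x₁ u` has type `a`. -/
def leftDomain [Fintype B] (cs : CoxeterSystem M W) (U : Finset B) (a : ℕ × Finset B) (v : W) :
    Set W :=
  {x | IsClique cs U ∧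
    cs.length (x * v⁻¹ * (cliqueProd cs U)⁻¹) + U.card + cs.length v = cs.length x ∧
    descentType cs (x * v⁻¹) = a}

/-- The elements `y = y₁ u v` (lengths adding) such that `y₁` has type `b`. -/
def rightDomain [Fintype B] (cs : CoxeterSystem M W) (U : Finset B) (b : ℕ × Finset B) (v : W) :
    Set W :=
  {y | cs.length (y * v⁻¹ * (cliqueProd cs U)⁻¹) + U.card + cs.length v = cs.length y ∧
    descentType cs (y * v⁻¹ * (cliqueProd cs U)⁻¹) = b}

/-- The partial isometry `δ_z ↦ δ_{z v}` with range `ℓ²(leftDomain)`. -/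
def leftOp [Fintype B] (cs : CoxeterSystem M W) (U : Finset B) (a : ℕ × Finset B) (v : W) :
    L2 W →L[ℂ] L2 W :=
  projOp (leftDomain cs U a v) * permOp (Equiv.mulRight v)

/-- The partial isometry `δ_y ↦ δ_{y v⁻¹ u⁻¹}` with initial space `ℓ²(rightDomain)`. -/
def rightOp [Fintype B] (cs : CoxeterSystem M W) (U : Finset B) (b : ℕ × Finset B) (v : W) :
    L2 W →L[ℂ] L2 W :=
  permOp (Equiv.mulRight (v⁻¹ * (cliqueProd cs U)⁻¹)) * projOp (rightDomain cs U b v)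

open scoped Classical in
theorem leftOp_mul_rightOp_delta_apply [Fintype B] (cs : CoxeterSystem M W) (U : Finset B)
    (c : (ℕ × Finset B) × (ℕ × Finset B)) (v : W) (X : L2 W →L[ℂ] L2 W) (x y : W) :
    (leftOp cs U c.1 v * X * rightOp cs U c.2 v) (delta y) x =
      if x ∈ leftDomain cs U c.1 v ∧ y ∈ rightDomain cs U c.2 v then
        X (delta (y * v⁻¹ * (cliqueProd cs U)⁻¹)) (x * v⁻¹) else 0 := by
  rw [mul_apply_eq_comp, mul_apply_eq_comp, leftOp, rightOp, mul_apply_eq_comp, mul_apply_eq_comp,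
    projOp_delta, projOp_apply, permOp_apply]
  by_cases hx : x ∈ leftDomain cs U c.1 v <;> by_cases hy : y ∈ rightDomain cs U c.2 v <;>
    simp [hx, hy, permOp_delta, mul_assoc]

theorem mem_domains_iff [Fintype B] (cs : CoxeterSystem M W) (n : ℕ) (U : Finset B) (v x y : W) :
    (x ∈ leftDomain cs U (descentType cs (x * v⁻¹)) v ∧
      y ∈ rightDomain cs U (descentType cs (y * v⁻¹ * (cliqueProd cs U)⁻¹)) v ∧
      (descentType cs (x * v⁻¹), descentType cs (y * v⁻¹ * (cliqueProd cs U)⁻¹)) ∈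
        typePairs B n) ↔
    IsCommonTail cs x y U v ∧
      cs.length (x * v⁻¹) + cs.length (y * v⁻¹ * (cliqueProd cs U)⁻¹) ≤ n := by
  simp only [leftDomain, rightDomain, typePairs, descentType, Set.mem_ofPred_eq, and_true,
    Finset.mem_filter, Finset.mem_product, Finset.mem_range, Finset.mem_univ,
    Finset.disjoint_left, true_and]
  constructor
  · rintro ⟨⟨h1, h2⟩, h3, -, h5, h6⟩
    exact ⟨⟨h1, h2, h3, fun i => @h6 i⟩, h5⟩
  · rintro ⟨⟨h1, h2, h3, h4⟩, h5⟩
    exact ⟨⟨h1, h2⟩, h3, by omega, h5, fun i => h4 i⟩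

/-- The part of the expansion of the cut-down with tails in the finite set `V`. -/
def cutApprox [Fintype B] (cs : CoxeterSystem M W) (q : ℝ) (n : ℕ) (V : Finset W)
    (X : L2 W →L[ℂ] L2 W) : L2 W →L[ℂ] L2 W :=
  ∑ β ∈ (Finset.univ : Finset (Finset B)) ×ˢ typePairs B n, param q ^ β.1.card •
    ∑ v ∈ V, leftOp cs β.1 β.2.1 v * X * rightOp cs β.1 β.2.2 v

open scoped Classical in
theorem cutApprox_delta_apply [Fintype B] (cs : CoxeterSystem M W) (q : ℝ) (n : ℕ) (V : Finset W)
    (X : L2 W →L[ℂ] L2 W) (x y : W) :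
    cutApprox cs q n V X (delta y) x =
      ∑ α ∈ (Finset.univ ×ˢ V).filter (fun α => IsCommonTail cs x y α.1 α.2 ∧
          cs.length (x * α.2⁻¹) + cs.length (y * α.2⁻¹ * (cliqueProd cs α.1)⁻¹) ≤ n),
        param q ^ α.1.card * X (delta (y * α.2⁻¹ * (cliqueProd cs α.1)⁻¹)) (x * α.2⁻¹) := by
  have h1 : cutApprox cs q n V X (delta y) x =
      ∑ U : Finset B, ∑ c ∈ typePairs B n, param q ^ U.card * ∑ v ∈ V,
        (leftOp cs U c.1 v * X * rightOp cs U c.2 v) (delta y) x := by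
    rw [cutApprox, sum_apply, sum_apply_apply, Finset.sum_product]
    refine Finset.sum_congr rfl fun U _ => Finset.sum_congr rfl fun c _ => ?_
    rw [smul_apply, sum_apply, lp.coeFn_smul, Pi.smul_apply, smul_eq_mul, sum_apply_apply]
  rw [h1, Finset.sum_filter, Finset.sum_product]
  refine Finset.sum_congr rfl fun U _ => ?_
  simp only [Finset.mul_sum]
  rw [Finset.sum_comm]
  refine Finset.sum_congr rfl fun v _ => ?_
  simp only [leftOp_mul_rightOp_delta_apply]
  -- only the pair of the actual types of the two elements contributes
  set c₀ := (descentType cs (x * v⁻¹), descentType cs (y * v⁻¹ * (cliqueProd cs U)⁻¹)) with hc₀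
  have h2 : ∀ c, c ≠ c₀ → ¬ (x ∈ leftDomain cs U c.1 v ∧ y ∈ rightDomain cs U c.2 v) := by
    rintro c hc ⟨hx, hy⟩
    exact hc (Prod.ext hx.2.2.symm hy.2.symm)
  by_cases h3 : c₀ ∈ typePairs B n
  · rw [Finset.sum_eq_single_of_mem c₀ h3 fun c _ hc => by rw [if_neg (h2 c hc), mul_zero],
      mul_ite, mul_zero]
    refine if_congr ?_ rfl rfl
    rw [← mem_domains_iff]
    tauto
  · rw [if_neg fun h => h3 ((mem_domains_iff cs n U v x y).2 h).2.2]
    refine Finset.sum_eq_zero fun c hc => ?_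
    rw [if_neg (h2 c (by rintro rfl; exact h3 hc)), mul_zero]

/-! ### Norm estimates -/

theorem card_leftDomain_le [Fintype B] (hM : M.IsRightAngled) (cs : CoxeterSystem M W)
    (U : Finset B) (a : ℕ × Finset B) (x : W) (t : Finset W)
    (ht : ∀ v ∈ t, x ∈ leftDomain cs U a v) : t.card ≤ (a.1 + 1) ^ Fintype.card B := by
  classical
  have hinj : Function.Injective fun v : W => x * v⁻¹ := fun v w h => by simpa using h
  rw [← Finset.card_image_of_injective t hinj]
  refine card_initialSegments_le hM cs x a.1 _ fun z hz => ?_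
  obtain ⟨v, hv, rfl⟩ := Finset.mem_image.1 hz
  obtain ⟨-, h1, h2⟩ := ht v hv
  refine ⟨congrArg Prod.fst h2, ?_⟩
  simpa using (length_of_tail cs h1).2.1

theorem card_rightDomain_le [Fintype B] (hM : M.IsRightAngled) (cs : CoxeterSystem M W)
    (U : Finset B) (b : ℕ × Finset B) (y : W) (t : Finset W)
    (ht : ∀ v ∈ t, y ∈ rightDomain cs U b v) : t.card ≤ (b.1 + 1) ^ Fintype.card B := by
  classical
  have hinj : Function.Injective fun v : W => y * v⁻¹ * (cliqueProd cs U)⁻¹ :=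
    fun v w h => by simpa using h
  rw [← Finset.card_image_of_injective t hinj]
  refine card_initialSegments_le hM cs y b.1 _ fun z hz => ?_
  obtain ⟨v, hv, rfl⟩ := Finset.mem_image.1 hz
  obtain ⟨h1, h2⟩ := ht v hv
  refine ⟨congrArg Prod.fst h2, ?_⟩
  have h3 : (y * v⁻¹ * (cliqueProd cs U)⁻¹)⁻¹ * y = cliqueProd cs U * v := by group
  have h4 := cs.length_mul_le (cliqueProd cs U) v
  have h5 := length_cliqueProd_le cs U
  have h6 := cs.length_mul_le (y * v⁻¹ * (cliqueProd cs U)⁻¹) (cliqueProd cs U * v)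
  rw [← h3, mul_inv_cancel_left, h3] at h6
  rw [h3]
  omega

theorem norm_matrixOp_cutApprox_le [Fintype B] (hM : M.IsRightAngled) (cs : CoxeterSystem M W)
    (q : ℝ) (n : ℕ) (V : Finset W) {k : ℕ} (x : Matrix (Fin k) (Fin k) (L2 W →L[ℂ] L2 W))
    (hx : ‖OperatorSpace.matrixOp x‖ ≤ 1) :
    ‖OperatorSpace.matrixOp (x.map (cutApprox cs q n V))‖ ≤
      (∑ U : Finset B, ‖param q‖ ^ U.card) * (((n : ℝ) + 1) * 2 ^ Fintype.card B) ^ 2 *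
        ((n : ℝ) + 1) ^ Fintype.card B := by
  have hterm : ∀ β ∈ (Finset.univ : Finset (Finset B)) ×ˢ typePairs B n,
      ‖param q ^ β.1.card • OperatorSpace.matrixOp
        (x.map fun a => ∑ v ∈ V, leftOp cs β.1 β.2.1 v * a * rightOp cs β.1 β.2.2 v)‖ ≤
      ‖param q‖ ^ β.1.card * ((n : ℝ) + 1) ^ Fintype.card B := by
    rintro ⟨U, a, b⟩ hβ
    simp only [typePairs, Finset.mem_product, Finset.mem_filter, Finset.mem_range] at hβ
    rw [norm_smul, norm_pow]
    gcongr
    refine (OperatorSpace.norm_matrixOp_sum_le V _ _ (C := ((n : ℝ) + 1) ^ Fintype.card B)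
      (by positivity) ?_ ?_ x).trans (mul_le_of_le_one_right (by positivity) hx)
    · intro ξ
      refine le_trans (Finset.sum_le_sum fun v _ => ?_) (sum_norm_projOp_sq_le V
        (leftDomain cs U a) (N := ((n : ℝ) + 1) ^ Fintype.card B) (fun x t _ ht => ?_) ξ)
      · rw [leftOp, star_mul, star_projOp, mul_apply_eq_comp]
        gcongr
        refine ContinuousLinearMap.le_of_opNorm_le _ ?_ _ |>.trans_eq (one_mul _)
        rw [ContinuousLinearMap.star_eq_adjoint, LinearIsometryEquiv.norm_map]
        exact norm_permOp_le _
      · have h1 := card_leftDomain_le hM cs U a x t ht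
        calc (t.card : ℝ) ≤ ((a.1 : ℝ) + 1) ^ Fintype.card B := by exact_mod_cast h1
          _ ≤ _ := by gcongr; exact_mod_cast Nat.lt_succ_iff.1 hβ.2.1.1.1
    · intro ξ
      refine le_trans (Finset.sum_le_sum fun v _ => ?_) (sum_norm_projOp_sq_le V
        (rightDomain cs U b) (N := ((n : ℝ) + 1) ^ Fintype.card B) (fun x t _ ht => ?_) ξ)
      · rw [rightOp, mul_apply_eq_comp]
        gcongr
        exact ContinuousLinearMap.le_of_opNorm_le _ (norm_permOp_le _) _ |>.trans_eq (one_mul _)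
      · have h1 := card_rightDomain_le hM cs U b x t ht
        calc (t.card : ℝ) ≤ ((b.1 : ℝ) + 1) ^ Fintype.card B := by exact_mod_cast h1
          _ ≤ _ := by gcongr; exact_mod_cast Nat.lt_succ_iff.1 hβ.2.1.2.1
  have hsum := OperatorSpace.matrixOp_sum_smul
    ((Finset.univ : Finset (Finset B)) ×ˢ typePairs B n) (fun β => param q ^ β.1.card)
    (fun β a => ∑ v ∈ V, leftOp cs β.1 β.2.1 v * a * rightOp cs β.1 β.2.2 v) x
  change OperatorSpace.matrixOp (x.map (cutApprox cs q n V)) = _ at hsum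
  rw [hsum]
  refine (norm_sum_le_of_le _ hterm).trans ?_
  rw [← Finset.sum_mul, Finset.sum_product]
  simp only [Finset.sum_const, nsmul_eq_mul]
  rw [← Finset.mul_sum, mul_comm ((typePairs B n).card : ℝ)]
  gcongr
  exact_mod_cast card_typePairs_le (B := B) n

theorem finite_length_le [Finite B] (cs : CoxeterSystem M W) (m : ℕ) :
    {v : W | cs.length v ≤ m}.Finite := by
  refine ((List.finite_length_le B m).image cs.wordProd).subset fun v hv => ?_
  obtain ⟨ω, hω, rfl⟩ := cs.exists_isReduced v
  exact ⟨ω, hω.eq.symm.le.trans hv, rfl⟩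

theorem norm_matrixOp_cutDown_le [Fintype B] (hM : M.IsRightAngled) (cs : CoxeterSystem M W)
    (q : ℝ) (n : ℕ) {k : ℕ} (x : Matrix (Fin k) (Fin k) (heckeAlgebra cs q))
    (hx : ‖OperatorSpace.matrixOp (x.map fun a => (a : L2 W →L[ℂ] L2 W))‖ ≤ 1) :
    ‖OperatorSpace.matrixOp (x.map fun a => (cutDown hM cs q n a : L2 W →L[ℂ] L2 W))‖ ≤
      (∑ U : Finset B, ‖param q‖ ^ U.card) * (((n : ℝ) + 1) * 2 ^ Fintype.card B) ^ 2 *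
        ((n : ℝ) + 1) ^ Fintype.card B := by
  classical
  refine norm_le_of_forall_finset _ (by positivity) fun F => ?_
  -- all tails of elements of `F` lie in a ball
  set V : Finset W := (finite_length_le cs (F.sup cs.length)).toFinset with hV
  refine ⟨_, norm_matrixOp_cutApprox_le hM cs q n V _ hx, fun ξ i z hz => ?_⟩
  have hVz : ∀ v, cs.length v ≤ cs.length z → v ∈ V := fun v hv => by
    rw [hV, Set.Finite.mem_toFinset]
    exact hv.trans (Finset.le_sup (f := cs.length) hz)
  have hop : ∀ a : heckeAlgebra cs q,
      projOp (F : Set W) * (cutDown hM cs q n a : L2 W →L[ℂ] L2 W) =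
        projOp (F : Set W) * cutApprox cs q n V (a : L2 W →L[ℂ] L2 W) := by
    intro a
    refine clm_ext fun y => ?_
    ext u
    rw [mul_apply_eq_comp, mul_apply_eq_comp, projOp_apply, projOp_apply]
    by_cases hu : u ∈ F
    · rw [if_pos (by exact_mod_cast hu), if_pos (by exact_mod_cast hu), cutApprox_delta_apply]
      refine cutDown_delta_apply hM cs q n a V u y fun v hv => ?_
      rw [hV, Set.Finite.mem_toFinset]
      exact hv.trans (Finset.le_sup (f := cs.length) hu)
    · rw [if_neg (by exact_mod_cast hu), if_neg (by exact_mod_cast hu)]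
  have hz' : ∀ (a : heckeAlgebra cs q) (f : L2 W),
      (cutDown hM cs q n a : L2 W →L[ℂ] L2 W) f z = cutApprox cs q n V a f z := by
    intro a f
    have h := congrArg (fun S : L2 W →L[ℂ] L2 W => S f z) (hop a)
    simp only [mul_apply_eq_comp, projOp_apply] at h
    rwa [if_pos (by exact_mod_cast hz), if_pos (by exact_mod_cast hz)] at h
  rw [OperatorSpace.matrixOp_apply, OperatorSpace.matrixOp_apply, sum_apply_apply, sum_apply_apply]
  exact Finset.sum_congr rfl fun j _ => hz' _ _

end cutdown

end Hecke

end

theorem mainTheorem6 {B W : Type*} [Finite B] [Group W] {M : CoxeterMatrix B}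
    (hM : M.IsRightAngled) (cs : CoxeterSystem M W) {q : ℝ} (hq : 0 < q) :
    ∃ P : Polynomial ℝ, ∀ n : ℕ,
      OperatorSpace.IsCompletelyBounded (Hecke.cutDown hM cs q n) ∧
      OperatorSpace.cbNorm (Hecke.cutDown hM cs q n) ≤ ENNReal.ofReal (P.eval (n : ℝ)) := by
  have := Fintype.ofFinite B
  let P : Polynomial ℝ :=
    Polynomial.C (∑ U : Finset B, ‖Hecke.param q‖ ^ U.card) *
      ((Polynomial.X + 1) * 2 ^ Fintype.card B) ^ 2 * (Polynomial.X + 1) ^ Fintype.card B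
  have hP : ∀ n : ℕ, OperatorSpace.cbNorm (Hecke.cutDown hM cs q n) ≤
      ENNReal.ofReal (P.eval (n : ℝ)) := by
    intro n
    refine iSup_le fun k => iSup_le fun x => iSup_le fun hx => ?_
    rw [← ofReal_norm]
    refine ENNReal.ofReal_le_ofReal ((Hecke.norm_matrixOp_cutDown_le hM cs q n x hx).trans_eq ?_)
    simp only [P, Polynomial.eval_mul, Polynomial.eval_C, Polynomial.eval_pow, Polynomial.eval_add,
      Polynomial.eval_X, Polynomial.eval_one, Polynomial.eval_ofNat]
  exact ⟨P, fun n => ⟨(hP n).trans_lt ENNReal.ofReal_lt_top, hP n⟩⟩
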